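/- **Setting.** Let $0<R_f'<R_f''$. Let $v_f\in C^2([0,R_f''];[0,\infty))$ with $v_f(R_f'')>0$ and, on $[0,R_f'']$, $v_f'\le 0$, $v_f+\rho v_f'>0$, $2v_f'+\rho v_f''\le 0$. Let $p\in C^2([R_f',\infty))$ with $p'>0$ and $2p'+\rho p''>0$; assume that $v_f+p$ is increasing on $[R_f',R_f'']$ and $v_f(\rho)<\rho p'(\rho)$ there. Put $V_{\max}=v_f(0)$, $V_f=v_f(R_f'')$, $W_{\max}=p(R_f'')+V_f$, $W_c=p(R_f')+v_f(R_f')$, $W_{\min}=W_c+v_f(R_f')-V_{\max}$, assume that $R_{\max}=p^{-1}(W_{\max})$ exists, and fix $V_c\in(0,V_f)$. States are $u=(\rho,v)$. Let $$\Omega_f=\{\rho\in[0,R_f''],\ v=v_f(\rho)\},\qquad \Omega_c=\{\rho\in[R_f',R_{\max}],\ v\in[0,V_c],\ W_c\le v+p(\rho)\le W_{\max}\},$$ $\Omega=\Omega_f\cup\Omega_c$, $\Omega_f'=\Omega_f\cap\{\rho<R_f'\}$, $\Omega_f''=\Omega_f\cap\{\rho\ge R_f'\}$. Let $w_1(u)=V_f$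 on $\Omega_f$ and $w_1(u)=v$ on $\Omega_c$; let $w_2(u)=W_c+v_f(R_f')-v_f(\rho)$ on $\Omega_f'$ and $w_2(u)=v+p(\rho)$ on $\Omega_c\cup\Omega_f''$. For $w\in[W_c,W_{\max}]$ let $\rho_f(w)\in[R_f',R_f'']$ be the solution of $v_f(\rho)+p(\rho)=w$. Let $\sigma(u_-,u_+)=(\rho_+v_+-\rho_-v_-)/(\rho_+-\rho_-)$ and $\mathcal G_e=\mathcal G_1\cup\mathcal G_2\cup\mathcal G_3$, where $$\mathcal G_1=\{(u_-,u_+)\in\Omega_f'\times\Omega_c:[w_2(u_+)-W_c]\rho_-=0\},\quad \mathcal G_2=\{(u_-,u_+)\in\Omega_f''\times\Omega_c: w_2(u_-)=w_2(u_+)\},$$ $$\mathcal G_3=\{(u_-,u_+)\in\Omega_c\times\Omega_f'': w_2(u_-)=w_2(u_+),\ v_-=V_c\}.$$ **Grid and approximate Riemann solver.** For $n\in\mathbb N$ let $\varepsilon_v=2^{-n}V_c$, $\varepsilon_w=2^{-n}(W_c-W_{\min})$, and let $\Omega^n$ be the set of $u\in\Omega$ with $w_2(u)\in\{W_{\min}+i\varepsilon_w: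 i\in\mathbb N\}\cap(-\infty,W_{\max}]$ and $w_1(u)\in\{i\varepsilon_v:0\le i\le 2^n\}\cup\{V_f\}$. The approximate Riemann solver $\mathcal R^n[u_\ell,u_r]$, $u_\ell,u_r\in\Omega^n$, is the self-similar piecewise constant function whose successive states, separated by fronts of speed $\sigma$, are obtained as follows (null waves are dropped). * $u_\ell,u_r\in\Omega_f$: one shock if $\rho_\ell<\rho_r$; if $\rho_\ell>\rho_r$, the rarefaction discretized by the free states with $w_2=w_2(u_\ell)-i\varepsilon_w$ (a single jump if $w_2(u_\ell)=w_2(u_r)$). * $u_\ell,u_r\in\Omega_c$: with $u_m\in\Omega_c$ given by $v_m=v_r$, $w_2(u_m)=w_2(u_\ell)$, a shock from $u_\ell$ to $u_m$ if $v_r<v_\ell$, or, if $v_r>v_\ell$, the rarefaction discretized by the states of $\Omega_c$ with $w_1=v_\ell+i\varepsilon_v$, $w_2=w_2(u_\ell)$; then a contact discontinuity from $u_m$ to $u_r$. * $u_\ell\in\Omega_f$, $u_r\in\Omega_c$: a jump from $u_\ell$ to $u_m\in\Omega_c$ given by $v_m=v_r$, $w_2(u_m)=\max\{W_c,w_2(u_\ell)\}$,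 then a contact discontinuity from $u_m$ to $u_r$ (if $\rho_\ell=0$ both have the same speed and form a single front). * $u_\ell\in\Omega_c$, $u_r\in\Omega_f$: the (discretized) rarefaction from $u_\ell$ to $u_m'\in\Omega_c$ given by $v_m'=V_c$, $w_2(u_m')=w_2(u_\ell)$; a jump from $u_m'$ to $u_m''=(\rho_m'',v_f(\rho_m''))$ with $\rho_m''=\rho_f(w_2(u_\ell))$; the (discretized) free wave from $u_m''$ to $u_r$. **Approximate solution.** Let $\bar u^n:\mathbb R\to\Omega^n$ be right continuous and piecewise constant with finitely many jumps. The wave-front tracking approximate solution $u^n$ is obtained by applying $\mathcal R^n$ at every jump of $\bar u^n$ at $t=0$, letting the fronts move with their speeds $\sigma$ until the first time two of them meet, applying $\mathcal R^n$ again at the jumps of the function so reached, and so on; at interaction times it is taken left continuous in time (so at an interaction point the interacting fronts form a single jump). It is considered at all times $t\ge 0$ that this construction reaches after finitely many interaction times. A *phase transition* of a function at $x$ is a jump at $x$ with one trace in $\Omega_f$ and the other one in $\Omega_c$; two discontinuities (or two phase transitions) *interact* at $(\tau,x)$, $\tau>0$, if two distinct curves of discontinuities (phase transitions) of $u^n$,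 defined for times in a left neighbourhood of $\tau$, both tend to $x$ as $t\uparrow\tau$. Let $N(t)$ be the number of phase transitions of $x\mapsto u^n(t,x)$. **Lemma.** For every $n$ and every such $\bar u^n$: 1. (Condition (E.3).) If $t>0$ and $u^n(t,\cdot)$ performs at $x$ a phase transition from $u_-$ to $u_+$, and $(t,x)$ is not a point where discontinuities interact, then $(u_-,u_+)\in\mathcal G_e$. 2. $N(t)<\infty$ for all $t\ge 0$, and $N(t)\le N(s)$ whenever $0\le s\le t$. 3. For $0\le s\le t$, $N(t)<N(s)$ if and only if two phase transitions interact at some $(\tau,x)$ with $s<\tau\le t$. 4. For $0\le s\le t$, $N(s)-N(t)$ is even. -/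

import Mathlib

open Set Filter Topology

namespace TwoPhase

/-- A traffic state `u = (ρ, v)`: density and velocity. -/
abbrev State := ℝ × ℝ

/-- The data of the two phase model and its standing assumptions. `Rf₁` and `Rf₂` are the
densities `R_f'` and `R_f''`; `Rmax = p⁻¹(W_max)` with `W_max = p(R_f'') + v_f(R_f'')`.
`vf` is only relevant on `[0, R_f'']` and `p` only on `[R_f', ∞)`. -/
structure Model where
  vf : ℝ → ℝ
  p : ℝ → ℝ
  Rf₁ : ℝ
  Rf₂ : ℝ
  Rmax : ℝ
  Vc : ℝ
  Rf₁_pos : 0 < Rf₁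
  Rf₁_lt : Rf₁ < Rf₂
  -- (H1)
  vf_contDiff : ContDiffOn ℝ 2 vf (Icc 0 Rf₂)
  vf_nonneg : ∀ ρ ∈ Icc 0 Rf₂, 0 ≤ vf ρ
  vf_pos : 0 < vf Rf₂
  vf_deriv : ∀ ρ ∈ Icc 0 Rf₂, derivWithin vf (Icc 0 Rf₂) ρ ≤ 0
  vf_flux : ∀ ρ ∈ Icc 0 Rf₂, 0 < vf ρ + ρ * derivWithin vf (Icc 0 Rf₂) ρ
  vf_concave : ∀ ρ ∈ Icc 0 Rf₂,
    2 * derivWithin vf (Icc 0 Rf₂) ρ + ρ * iteratedDerivWithin 2 vf (Icc 0 Rf₂) ρ ≤ 0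
  -- (H2)
  p_contDiff : ContDiffOn ℝ 2 p (Ici Rf₁)
  p_deriv : ∀ ρ ∈ Ici Rf₁, 0 < derivWithin p (Ici Rf₁) ρ
  p_convex : ∀ ρ ∈ Ici Rf₁,
    0 < 2 * derivWithin p (Ici Rf₁) ρ + ρ * iteratedDerivWithin 2 p (Ici Rf₁) ρ
  -- (H3)
  vf_add_p : StrictMonoOn (fun ρ => vf ρ + p ρ) (Icc Rf₁ Rf₂)
  capacity_drop : ∀ ρ ∈ Icc Rf₁ Rf₂, vf ρ < ρ * derivWithin p (Ici Rf₁) ρ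
  -- the maximal density and the maximal congested velocity
  Rmax_ge : Rf₁ ≤ Rmax
  p_Rmax : p Rmax = p Rf₂ + vf Rf₂
  Vc_pos : 0 < Vc
  Vc_lt : Vc < vf Rf₂

/-- Speed of propagation of a discontinuity from `a` to `b`. -/
noncomputable def sigma (a b : State) : ℝ := (b.1 * b.2 - a.1 * a.2) / (b.1 - a.1)

/-- The piecewise constant, right continuous function with leftmost state `ul` that takes the value
`u` to the right of `y` for each entry `(y, u)` of the list (ordered from left to right). If several
consecutive entries sit at the same point, the last one counts. -/
noncomputable def profile : State → List (ℝ × State) → ℝ → State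
  | ul, [], _ => ul
  | ul, (y, u) :: L, x => if x < y then ul else profile u L x

/-- Positions of the wave-fronts after time `s`, each one moving with its speed `sigma`. -/
noncomputable def evolve : State → List (ℝ × State) → ℝ → List (ℝ × State)
  | _, [], _ => []
  | ul, (y, u) :: L, s => (y + sigma ul u * s, u) :: evolve u L s

/-- The times at which two consecutive approaching wave-fronts meet. -/
noncomputable def meetTimes : State → List (ℝ × State) → List ℝ
  | ul, (y, u) :: (y', u') :: L =>
      if sigma u u' < sigma ul u then
        (y' - y) / (sigma ul u - sigma u u') :: meetTimes u ((y', u') :: L)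
      else meetTimes u ((y', u') :: L)
  | _, _ => []

/-- Replaces consecutive fronts at the same position by a single jump. -/
noncomputable def collapse : List (ℝ × State) → List (ℝ × State)
  | a :: b :: L => if a.1 = b.1 then collapse (b :: L) else a :: collapse (b :: L)
  | L => L

/-- Two distinct continuous curves of points satisfying `P`, defined on a left neighbourhood of
`t`, meet at `(t, x)`. -/
def MeetAt (P : ℝ → ℝ → Prop) (t x : ℝ) : Prop :=
  ∃ δ > 0, ∃ ξ₁ ξ₂ : ℝ → ℝ,
    ContinuousOn ξ₁ (Ioo (t - δ) t) ∧ ContinuousOn ξ₂ (Ioo (t - δ) t) ∧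
    Tendsto ξ₁ (𝓝[<] t) (𝓝 x) ∧ Tendsto ξ₂ (𝓝[<] t) (𝓝 x) ∧
    ∀ s ∈ Ioo (t - δ) t, ξ₁ s < ξ₂ s ∧ P s (ξ₁ s) ∧ P s (ξ₂ s)

/-- Two discontinuities of `u` interact at `(t, x)`. -/
def FrontsInteract (u : ℝ → ℝ → State) (t x : ℝ) : Prop :=
  MeetAt (fun s y => ¬ ContinuousAt (u s) y) t x

namespace Model

variable (M : Model)

def Vmax : ℝ := M.vf 0
def Vf : ℝ := M.vf M.Rf₂
def Wmax : ℝ := M.p M.Rf₂ + M.Vf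
def Wc : ℝ := M.p M.Rf₁ + M.vf M.Rf₁
def Wmin : ℝ := M.Wc + M.vf M.Rf₁ - M.Vmax

/-- Free phases. -/
def Omegaf : Set State := {u | u.1 ∈ Icc 0 M.Rf₂ ∧ u.2 ∈ Icc M.Vf M.Vmax ∧ u.2 = M.vf u.1}

/-- Congested phases (`p` is defined only for `ρ ≥ R_f'`). -/
def Omegac : Set State :=
  {u | u.1 ∈ Icc M.Rf₁ M.Rmax ∧ u.2 ∈ Icc 0 M.Vc ∧ u.2 + M.p u.1 ∈ Icc M.Wc M.Wmax}

def Omegaf₁ : Set State := {u | u ∈ M.Omegaf ∧ u.1 < M.Rf₁}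
def Omegaf₂ : Set State := {u | u ∈ M.Omegaf ∧ M.Rf₁ ≤ u.1}
def Omega : Set State := M.Omegaf ∪ M.Omegac

open Classical in
/-- First extended Riemann invariant. -/
noncomputable def w1 (u : State) : ℝ := if u ∈ M.Omegaf then M.Vf else u.2

open Classical in
/-- Second extended Riemann invariant. -/
noncomputable def w2 (u : State) : ℝ :=
  if u ∈ M.Omegaf₁ then M.Wc + M.vf M.Rf₁ - M.vf u.1 else u.2 + M.p u.1

/-- The inverse of the increasing function `p` on `[R_f', R_max]`. -/
noncomputable def pinv (w : ℝ) : ℝ := Function.invFunOn M.p (Icc M.Rf₁ M.Rmax) w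

/-- The density `ρ_f(w) ∈ [R_f', R_f'']` with `v_f(ρ) + p(ρ) = w`, for `w ∈ [W_c, W_max]`. -/
noncomputable def rhof (w : ℝ) : ℝ :=
  Function.invFunOn (fun ρ => M.vf ρ + M.p ρ) (Icc M.Rf₁ M.Rf₂) w

/-- The congested state with Riemann invariants `(v, w)`. -/
noncomputable def congState (v w : ℝ) : State := (M.pinv (w - v), v)

/-- The free state with second Riemann invariant `w`. -/
noncomputable def freeState (w : ℝ) : State := Function.invFunOn M.w2 M.Omegaf w

/-! ### Admissible phase transitions -/

def G1 : Set (State × State) :=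
  {q | q.1 ∈ M.Omegaf₁ ∧ q.2 ∈ M.Omegac ∧ (M.w2 q.2 - M.Wc) * q.1.1 = 0}
def G2 : Set (State × State) :=
  {q | q.1 ∈ M.Omegaf₂ ∧ q.2 ∈ M.Omegac ∧ M.w2 q.1 = M.w2 q.2}
def G3 : Set (State × State) :=
  {q | q.1 ∈ M.Omegac ∧ q.2 ∈ M.Omegaf₂ ∧ M.w2 q.1 = M.w2 q.2 ∧ q.1.2 = M.Vc}
def Ge : Set (State × State) := M.G1 ∪ M.G2 ∪ M.G3

/-! ### The grid and the approximate Riemann solver -/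

noncomputable def epsv (n : ℕ) : ℝ := M.Vc / 2 ^ n
noncomputable def epsw (n : ℕ) : ℝ := (M.Wc - M.Wmin) / 2 ^ n

def gridW (n : ℕ) : Set ℝ := {w | (∃ i : ℕ, w = M.Wmin + i * M.epsw n) ∧ w ≤ M.Wmax}
def gridV (n : ℕ) : Set ℝ := {v | ∃ i : ℕ, i ≤ 2 ^ n ∧ v = i * M.epsv n} ∪ {M.Vf}
def grid (n : ℕ) : Set State := {u | u ∈ M.Omega ∧ M.w1 u ∈ M.gridV n ∧ M.w2 u ∈ M.gridW n}

open Classical in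
/-- The wave from `ul` to `ur` in the free phase, as the list of the states following `ul`: nothing
if the states agree, a discretized rarefaction if the density decreases, a shock if it increases. -/
noncomputable def freeWave (n : ℕ) (ul ur : State) : List State :=
  if ul = ur then []
  else if ur.1 < ul.1 then
    (List.range (⌊(M.w2 ul - M.w2 ur) / M.epsw n⌋₊ - 1)).map
      (fun i => M.freeState (M.w2 ul - (i + 1 : ℕ) * M.epsw n)) ++ [ur]
  else [ur]

open Classical in
/-- The wave of the first family from the congested state `ul` to the state with velocity `v` and
the same second Riemann invariant, as the list of the states following `ul`: nothing if the velocity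
agrees, a discretized rarefaction if it increases, a shock if it decreases. -/
noncomputable def firstWave (n : ℕ) (ul : State) (v : ℝ) : List State :=
  if ul.2 = v then []
  else if ul.2 < v then
    (List.range (⌊(v - ul.2) / M.epsv n⌋₊ - 1)).map
      (fun i => M.congState (ul.2 + (i + 1 : ℕ) * M.epsv n) (M.w2 ul)) ++ [M.congState v (M.w2 ul)]
  else [M.congState v (M.w2 ul)]

open Classical in
/-- A possibly null contact discontinuity. -/
noncomputable def contact (um ur : State) : List State := if um = ur then [] else [ur]

open Classical in
/-- The approximate Riemann solver `ℛⁿ[ul, ur]`: the list of the states following `ul`, from left to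
right, the last one being `ur`; consecutive states are separated by a front of speed `sigma`. -/
noncomputable def riemann (n : ℕ) (ul ur : State) : List State :=
  if ul ∈ M.Omegaf then
    if ur ∈ M.Omegaf then M.freeWave n ul ur
    else
      let um := M.congState ur.2 (max M.Wc (M.w2 ul))
      um :: contact um ur
  else
    if ur ∈ M.Omegaf then
      let um : State := (M.rhof (M.w2 ul), M.vf (M.rhof (M.w2 ul)))
      M.firstWave n ul M.Vc ++ um :: M.freeWave n um ur
    else M.firstWave n ul ur.2 ++ contact (M.congState ur.2 (M.w2 ul)) ur

/-! ### The wave-front tracking approximate solution -/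

/-- Applies the approximate Riemann solver at each jump of a piecewise constant function. -/
noncomputable def resolve (n : ℕ) : State → List (ℝ × State) → List (ℝ × State)
  | _, [] => []
  | ul, (y, u) :: L => (M.riemann n ul u).map (fun a => (y, a)) ++ resolve n u L

/-- The wave-front tracking algorithm, started from the piecewise constant function with leftmost
state `ul` and jumps `J`. The `k`-th entry is the `k`-th interaction time (`0` for `k = 0`, and `⊤`
if there are less than `k` interaction times), with the fronts that issue from it. -/
noncomputable def tracking (n : ℕ) (ul : State) (J : List (ℝ × State)) :
    ℕ → WithTop ℝ × List (ℝ × State)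
  | 0 => (0, M.resolve n ul J)
  | k + 1 =>
      let T := (tracking n ul J k).1
      let L := (tracking n ul J k).2
      let τ := (meetTimes ul L).minimum
      (T + τ, M.resolve n ul (collapse (evolve ul L (τ.untopD 0))))

/-- The `k`-th interaction time. -/
noncomputable def time (n : ℕ) (ul : State) (J : List (ℝ × State)) (k : ℕ) : WithTop ℝ :=
  (M.tracking n ul J k).1

/-- The time `t` is reached by the algorithm after finitely many interactions. -/
def Reached (n : ℕ) (ul : State) (J : List (ℝ × State)) (t : ℝ) : Prop :=
  ∃ k, (t : WithTop ℝ) ≤ M.time n ul J k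

open Classical in
/-- The approximate solution `uⁿ(t, x)`, left continuous in time. It is meaningful for the times
`t ≥ 0` that are reached. -/
noncomputable def approx (n : ℕ) (ul : State) (J : List (ℝ × State)) (t x : ℝ) : State :=
  if h : ∃ k, M.time n ul J k < t ∧ (t : WithTop ℝ) ≤ M.time n ul J (k + 1) then
    profile ul (evolve ul (M.tracking n ul J h.choose).2
      (t - (M.time n ul J h.choose).untopD 0)) x
  else profile ul J x

/-! ### Phase transitions -/

/-- The function `g` performs a phase transition at `x`, with traces `um` and `up`. -/
def IsPhaseTransition (g : ℝ → State) (x : ℝ) (um up : State) : Prop :=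
  Tendsto g (𝓝[<] x) (𝓝 um) ∧ Tendsto g (𝓝[>] x) (𝓝 up) ∧
    ((um ∈ M.Omegaf ∧ up ∈ M.Omegac) ∨ (um ∈ M.Omegac ∧ up ∈ M.Omegaf))

/-- The points at which `g` performs a phase transition. -/
def phaseTransitions (g : ℝ → State) : Set ℝ := {x | ∃ um up, M.IsPhaseTransition g x um up}

/-- The number of phase transitions performed by `g`. -/
noncomputable def numPT (g : ℝ → State) : ℕ := (M.phaseTransitions g).ncard

/-- Two phase transitions of `u` interact at `(t, x)`. -/
def PhaseTransitionsInteract (u : ℝ → ℝ → State) (t x : ℝ) : Prop :=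
  MeetAt (fun s y => y ∈ M.phaseTransitions (u s)) t x

end Model

end TwoPhase

/-!
The fan of waves that solves a Riemann problem has increasing speeds, contains at most one phase
transition, namely when the data lie in different phases, and all its phase transitions are in
`𝒢_e`. Between two interaction times the fronts keep their order, so that away from the interactions
every jump belongs to a single fan, which is (E.3). When fronts meet, they merge into one jump,
which changes the phase if and only if an odd number of the merged fronts do, and the new fan
contains a phase transition in exactly this case. Hence every interaction removes an even number of
phase transitions, and a positive one if and only if two phase transitions meet.
-/

namespace TwoPhase

/-! ### Points that occur an odd number of times in a list -/

section OddPoints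

variable {α : Type*} [DecidableEq α]

/-- The points that occur an odd number of times in a list: the phase transitions that are left
when those sitting at the same point are merged. -/
def oddPoints (l : List α) : Finset α := {x ∈ l.toFinset | Odd (l.count x)}

theorem mem_oddPoints {l : List α} {x : α} : x ∈ oddPoints l ↔ Odd (l.count x) := by
  simp only [oddPoints, Finset.mem_filter, List.mem_toFinset, and_iff_right_iff_imp]
  exact fun h => List.count_pos_iff.1 h.pos

theorem mem_oddPoints_of_nodup {l : List α} (hl : l.Nodup) {x : α} : x ∈ oddPoints l ↔ x ∈ l := by
  rw [mem_oddPoints, hl.count]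
  split_ifs with hx <;> simp [hx]

theorem card_oddPoints_add (l : List α) :
    (oddPoints l).card + 2 * ∑ x ∈ l.toFinset, l.count x / 2 = l.length := by
  have hmod (x : α) : (if Odd (l.count x) then 1 else 0) = l.count x % 2 := by
    split_ifs with h
    · exact (Nat.odd_iff.1 h).symm
    · exact (Nat.not_odd_iff.1 h).symm
  rw [oddPoints, Finset.card_filter, Finset.mul_sum, ← Finset.sum_add_distrib,
    ← List.sum_toFinset_count_eq_length l]
  exact Finset.sum_congr rfl fun x _ => by rw [hmod, Nat.mod_add_div]

theorem card_oddPoints_le (l : List α) : (oddPoints l).card ≤ l.length :=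
  (Nat.le_add_right _ _).trans (card_oddPoints_add l).le

theorem even_length_sub_card_oddPoints (l : List α) : Even (l.length - (oddPoints l).card) := by
  rw [← card_oddPoints_add l, Nat.add_sub_cancel_left]
  exact even_two_mul _

theorem card_oddPoints_lt_length_iff {l : List α} : (oddPoints l).card < l.length ↔ ¬ l.Nodup := by
  rw [← card_oddPoints_add l, Nat.lt_add_right_iff_pos, Nat.pos_iff_ne_zero, not_iff_not,
    mul_eq_zero_iff_left two_ne_zero, Finset.sum_eq_zero_iff, List.nodup_iff_count_le_one]
  refine ⟨fun h x => ?_, fun h x _ => Nat.div_eq_of_lt ((h x).trans_lt one_lt_two)⟩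
  by_cases hx : x ∈ l
  · have := h x (List.mem_toFinset.2 hx)
    lia
  · simp [List.count_eq_zero_of_not_mem hx]

end OddPoints

theorem lt_iff_exists_succ_lt {α : Type*} [LinearOrder α] {c : ℕ → α} (hc : Antitone c) {i j : ℕ}
    (hij : i ≤ j) : c j < c i ↔ ∃ k, i ≤ k ∧ k < j ∧ c (k + 1) < c k := by
  constructor
  · contrapose!
    intro h
    induction j, hij using Nat.le_induction with
    | base => exact le_rfl
    | succ j hij ih =>
      exact (ih fun k hik hkj => h k hik (hkj.trans j.lt_succ_self)).trans
        (h j hij j.lt_succ_self)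
  · rintro ⟨k, hik, hkj, hlt⟩
    exact (hc hkj).trans_lt (hlt.trans_le (hc hik))

theorem getLastD_append {α : Type*} (d : α) (A B : List α) :
    (A ++ B).getLastD d = B.getLastD (A.getLastD d) := by
  induction A generalizing d with
  | nil => rfl
  | cons a _ ih => simp only [List.cons_append, List.getLastD_cons, ih]

/-! ### Step functions -/

section Steps

variable {K K' α : Type*}

open Classical in
/-- The keys of the jumps that enter or leave the set `F`, for the step function with leftmost value
`d` whose jumps are listed from left to right, as in `profile`. -/
noncomputable def crossings (F : Set α) : α → List (K × α) → List K
  | _, [] => []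
  | d, (y, u) :: L => if (d ∈ F ↔ u ∈ F) then crossings F u L else y :: crossings F u L

theorem crossings_append (F : Set α) (d : α) (A B : List (K × α)) :
    crossings F d (A ++ B) =
      crossings F d A ++ crossings F ((A.map Prod.snd).getLastD d) B := by
  induction A generalizing d with
  | nil => rfl
  | cons a A ih =>
    simp only [List.cons_append, crossings, List.map_cons, List.getLastD_cons]
    split_ifs <;> simp only [ih, List.cons_append]

theorem crossings_map (F : Set α) (d : α) (L : List (K × α)) (f : K → K') :
    crossings F d (L.map (Prod.map f id)) = (crossings F d L).map f := by
  induction L generalizing d with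
  | nil => rfl
  | cons a L ih =>
    obtain ⟨y, u⟩ := a
    simp only [List.map_cons, crossings, Prod.map_apply, id]
    split_ifs <;> simp only [ih, List.map_cons]

theorem crossings_sublist (F : Set α) (d : α) (L : List (K × α)) :
    (crossings F d L).Sublist (L.map Prod.fst) := by
  induction L generalizing d with
  | nil => exact List.Sublist.refl _
  | cons a L ih =>
    simp only [List.map_cons, crossings]
    split_ifs
    · exact (ih _).cons _
    · exact (ih _).cons_cons _

theorem exists_mem_of_mem_crossings {F : Set α} {d : α} {L : List (K × α)} {k : K}
    (h : k ∈ crossings F d L) : ∃ a ∈ L, a.1 = k :=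
  List.mem_map.1 ((crossings_sublist F d L).subset h)

variable [LinearOrder K] [LinearOrder K']

/-- The value to the left of `x` of the step function with leftmost value `d` and jumps `L`. -/
def leftTrace : α → List (K × α) → K → α
  | d, [], _ => d
  | d, (y, u) :: L, x => if y < x then leftTrace u L x else d

/-- The value to the right of `x` of the step function with leftmost value `d` and jumps `L`. -/
def rightTrace : α → List (K × α) → K → α
  | d, [], _ => d
  | d, (y, u) :: L, x => if x < y then d else rightTrace u L x

theorem leftTrace_mem (d : α) (L : List (K × α)) (x : K) :
    leftTrace d L x ∈ d :: L.map Prod.snd := by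
  induction L generalizing d with
  | nil => exact List.mem_cons_self
  | cons a L ih =>
    rw [leftTrace]
    split_ifs
    · exact List.mem_cons_of_mem _ (ih _)
    · exact List.mem_cons_self

theorem rightTrace_mem (d : α) (L : List (K × α)) (x : K) :
    rightTrace d L x ∈ d :: L.map Prod.snd := by
  induction L generalizing d with
  | nil => exact List.mem_cons_self
  | cons a L ih =>
    rw [rightTrace]
    split_ifs
    · exact List.mem_cons_self
    · exact List.mem_cons_of_mem _ (ih _)

theorem leftTrace_eq_of_forall_le {d : α} {L : List (K × α)} {x : K} (h : ∀ a ∈ L, x ≤ a.1) :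
    leftTrace d L x = d := by
  cases L with
  | nil => rfl
  | cons a L => exact if_neg (h a List.mem_cons_self).not_gt

theorem rightTrace_eq_of_forall_lt {d : α} {L : List (K × α)} {x : K} (h : ∀ a ∈ L, x < a.1) :
    rightTrace d L x = d := by
  cases L with
  | nil => rfl
  | cons a L => exact if_pos (h a List.mem_cons_self)

theorem leftTrace_map {d : α} {L : List (K × α)} {f : K → K'} {x : K} {x' : K'}
    (h : ∀ a ∈ L, f a.1 < x' ↔ a.1 < x) :
    leftTrace d (L.map (Prod.map f id)) x' = leftTrace d L x := by
  induction L generalizing d with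
  | nil => rfl
  | cons a L ih =>
    obtain ⟨y, u⟩ := a
    simp only [List.map_cons, Prod.map_apply, leftTrace, id, h (y, u) List.mem_cons_self,
      ih fun b hb => h b (List.mem_cons_of_mem _ hb)]

theorem rightTrace_map {d : α} {L : List (K × α)} {f : K → K'} {x : K} {x' : K'}
    (h : ∀ a ∈ L, x' < f a.1 ↔ x < a.1) :
    rightTrace d (L.map (Prod.map f id)) x' = rightTrace d L x := by
  induction L generalizing d with
  | nil => rfl
  | cons a L ih =>
    obtain ⟨y, u⟩ := a
    simp only [List.map_cons, Prod.map_apply, rightTrace, id, h (y, u) List.mem_cons_self,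
      ih fun b hb => h b (List.mem_cons_of_mem _ hb)]

theorem leftTrace_append_left {d : α} {A B : List (K × α)} {x : K} (h : ∃ a ∈ A, x ≤ a.1) :
    leftTrace d (A ++ B) x = leftTrace d A x := by
  induction A generalizing d with
  | nil => simp at h
  | cons a A ih =>
    simp only [List.cons_append, leftTrace]
    split_ifs with ha
    · obtain ⟨b, hb, hx⟩ := h
      exact ih ⟨b, (List.mem_cons.1 hb).resolve_left (by rintro rfl; exact ha.not_ge hx), hx⟩
    · rfl

theorem leftTrace_append_right {d : α} {A B : List (K × α)} {x : K} (h : ∀ a ∈ A, a.1 < x) :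
    leftTrace d (A ++ B) x = leftTrace ((A.map Prod.snd).getLastD d) B x := by
  induction A generalizing d with
  | nil => rfl
  | cons a A ih =>
    simp only [List.cons_append, leftTrace, List.map_cons, List.getLastD_cons,
      if_pos (h a List.mem_cons_self), ih fun b hb => h b (List.mem_cons_of_mem _ hb)]

theorem rightTrace_append_left {d : α} {A B : List (K × α)} {x : K} (h : ∀ b ∈ B, x < b.1) :
    rightTrace d (A ++ B) x = rightTrace d A x := by
  induction A generalizing d with
  | nil => exact rightTrace_eq_of_forall_lt h
  | cons a A ih => simp only [List.cons_append, rightTrace, ih]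

theorem rightTrace_append_right {d : α} {A B : List (K × α)} {x : K} (h : ∀ a ∈ A, a.1 ≤ x) :
    rightTrace d (A ++ B) x = rightTrace ((A.map Prod.snd).getLastD d) B x := by
  induction A generalizing d with
  | nil => rfl
  | cons a A ih =>
    simp only [List.cons_append, rightTrace, List.map_cons, List.getLastD_cons,
      if_neg (h a List.mem_cons_self).not_gt, ih fun b hb => h b (List.mem_cons_of_mem _ hb)]

theorem odd_count_crossings {F : Set α} {d : α} {L : List (K × α)}
    (hL : L.Pairwise fun a b => a.1 ≤ b.1) (x : K) :
    Odd ((crossings F d L).count x) ↔ ¬ (leftTrace d L x ∈ F ↔ rightTrace d L x ∈ F) := by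
  induction L generalizing d with
  | nil => simp [crossings, leftTrace, rightTrace]
  | cons a L ih =>
    obtain ⟨y, u⟩ := a
    obtain ⟨hy, hL⟩ := List.pairwise_cons.1 hL
    have ih := ih (d := u) hL
    simp only [crossings, leftTrace, rightTrace]
    rcases lt_trichotomy y x with h | rfl | h
    · rw [if_pos h, if_neg h.not_gt, ← ih]
      split_ifs
      · rfl
      · rw [List.count_cons_of_ne h.ne]
    · rw [leftTrace_eq_of_forall_le hy] at ih
      rw [if_neg (lt_irrefl y), if_neg (lt_irrefl y)]
      split_ifs with hF
      · rw [ih, hF]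
      · rw [List.count_cons_self, Nat.odd_add_one, ih]
        tauto
    · have hx : x ∉ crossings F d ((y, u) :: L) := fun hx => by
        obtain ⟨a, ha, rfl⟩ := exists_mem_of_mem_crossings hx
        rcases List.mem_cons.1 ha with rfl | ha
        · exact lt_irrefl _ h
        · exact (hy a ha).not_gt h
      rw [← crossings, List.count_eq_zero_of_not_mem hx, if_neg h.not_gt, if_pos h]
      simp

/-- At each jump the left and the right trace are related by `r`. -/
def JumpsSatisfy (r : α → α → Prop) (d : α) (L : List (K × α)) : Prop :=
  ∀ a ∈ L, r (leftTrace d L a.1) (rightTrace d L a.1)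

namespace JumpsSatisfy

variable {r : α → α → Prop} {d : α} {A B L : List (K × α)}

theorem append (hAB : ∀ a ∈ A, ∀ b ∈ B, a.1 < b.1) (hA : JumpsSatisfy r d A)
    (hB : JumpsSatisfy r ((A.map Prod.snd).getLastD d) B) : JumpsSatisfy r d (A ++ B) := by
  intro a ha
  rcases List.mem_append.1 ha with ha | ha
  · rw [leftTrace_append_left ⟨a, ha, le_rfl⟩, rightTrace_append_left (hAB a ha)]
    exact hA a ha
  · rw [leftTrace_append_right fun c hc => hAB c hc a ha,
      rightTrace_append_right fun c hc => (hAB c hc a ha).le]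
    exact hB a ha

theorem map (hL : JumpsSatisfy r d L) {f : K → K'} (hf : StrictMono f) :
    JumpsSatisfy r d (L.map (Prod.map f id)) := by
  intro a ha
  obtain ⟨b, hb, rfl⟩ := List.mem_map.1 ha
  rw [Prod.map_fst, leftTrace_map fun _ _ => hf.lt_iff_lt, rightTrace_map fun _ _ => hf.lt_iff_lt]
  exact hL b hb

theorem of_pairwise (hL : L.Pairwise fun a b => a.1 ≤ b.1)
    (hr : (d :: L.map Prod.snd).Pairwise r) : JumpsSatisfy r d L := by
  induction L generalizing d with
  | nil => simp [JumpsSatisfy]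
  | cons a L ih =>
    obtain ⟨y, u⟩ := a
    obtain ⟨hy, hL⟩ := List.pairwise_cons.1 hL
    obtain ⟨hu, hr⟩ := List.pairwise_cons.1 hr
    have hfirst : r (leftTrace d ((y, u) :: L) y) (rightTrace d ((y, u) :: L) y) := by
      rw [leftTrace, rightTrace, if_neg (lt_irrefl y), if_neg (lt_irrefl y)]
      exact hu _ (rightTrace_mem u L y)
    rintro b (_ | ⟨_, hb⟩)
    · exact hfirst
    · rcases (hy b hb).lt_or_eq with h | h
      · rw [leftTrace, rightTrace, if_pos h, if_neg h.not_gt]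
        exact ih hL hr b hb
      · rwa [← h]

end JumpsSatisfy

end Steps

/-! ### Profiles -/

section Profile

variable {ul : State} {L : List (ℝ × State)} {x : ℝ}

theorem profile_eventuallyEq_right :
    profile ul L =ᶠ[𝓝[>] x] fun _ => rightTrace ul L x := by
  induction L generalizing ul with
  | nil => exact EventuallyEq.rfl
  | cons a L ih =>
    obtain ⟨y, u⟩ := a
    by_cases h : x < y
    · filter_upwards [nhdsWithin_le_nhds (Iio_mem_nhds h)] with z hz
      rw [profile, rightTrace, if_pos h, if_pos (mem_Iio.1 hz)]
    · filter_upwards [ih (ul := u), self_mem_nhdsWithin] with z hz hxz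
      rw [profile, rightTrace, if_neg h, if_neg ((not_lt.1 h).trans_lt hxz).not_gt, hz]

theorem profile_eventuallyEq_left :
    profile ul L =ᶠ[𝓝[<] x] fun _ => leftTrace ul L x := by
  induction L generalizing ul with
  | nil => exact EventuallyEq.rfl
  | cons a L ih =>
    obtain ⟨y, u⟩ := a
    by_cases h : y < x
    · filter_upwards [ih (ul := u), nhdsWithin_le_nhds (Ioi_mem_nhds h)] with z hz hyz
      rw [profile, leftTrace, if_pos h, if_neg (mem_Ioi.1 hyz).not_gt, hz]
    · filter_upwards [self_mem_nhdsWithin] with z hz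
      rw [profile, leftTrace, if_neg h, if_pos ((mem_Iio.1 hz).trans_le (not_lt.1 h))]

theorem tendsto_profile_right : Tendsto (profile ul L) (𝓝[>] x) (𝓝 (rightTrace ul L x)) :=
  tendsto_nhds_of_eventually_eq profile_eventuallyEq_right

theorem tendsto_profile_left : Tendsto (profile ul L) (𝓝[<] x) (𝓝 (leftTrace ul L x)) :=
  tendsto_nhds_of_eventually_eq profile_eventuallyEq_left

theorem not_continuousAt_profile (h : leftTrace ul L x ≠ rightTrace ul L x) :
    ¬ ContinuousAt (profile ul L) x := fun hc =>
  h <| (tendsto_nhds_unique tendsto_profile_left (hc.mono_left nhdsWithin_le_nhds)).trans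
    (tendsto_nhds_unique tendsto_profile_right (hc.mono_left nhdsWithin_le_nhds)).symm

theorem profile_collapse (ul : State) (L : List (ℝ × State)) :
    profile ul (collapse L) = profile ul L := by
  funext x
  induction L using collapse.induct generalizing ul with
  | case1 a b L h ih =>
    rw [collapse, if_pos h, ih, profile, profile, profile, h]
    split_ifs <;> rfl
  | case2 a b L h ih =>
    rw [collapse, if_neg h]
    simp only [profile, ih]
  | case3 L hL =>
    unfold collapse
    split
    · exact absurd rfl (hL _ _ _)
    · rfl

theorem collapse_sublist (L : List (ℝ × State)) : (collapse L).Sublist L := by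
  induction L using collapse.induct with
  | case1 a b L h ih =>
    rw [collapse, if_pos h]
    exact ih.cons a
  | case2 a b L h ih =>
    rw [collapse, if_neg h]
    exact ih.cons_cons a
  | case3 L hL =>
    unfold collapse
    split
    · exact absurd rfl (hL _ _ _)
    · exact List.Sublist.refl _

theorem pairwise_lt_collapse {L : List (ℝ × State)} (hL : L.Pairwise fun a b => a.1 ≤ b.1) :
    (collapse L).Pairwise fun a b => a.1 < b.1 := by
  induction L using collapse.induct with
  | case1 a b L h ih =>
    rw [collapse, if_pos h]
    exact ih hL.of_cons
  | case2 a b L h ih =>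
    rw [collapse, if_neg h]
    obtain ⟨ha, hbL⟩ := List.pairwise_cons.1 hL
    have hab : a.1 < b.1 := lt_of_le_of_ne (ha b List.mem_cons_self) h
    refine List.pairwise_cons.2 ⟨fun c hc => ?_, ih hbL⟩
    rcases List.mem_cons.1 ((collapse_sublist _).subset hc) with rfl | hc
    · exact hab
    · exact hab.trans_le (List.rel_of_pairwise_cons hbL hc)
  | case3 L hL' =>
    match L, hL' with
    | [], _ => exact List.Pairwise.nil
    | [a], _ => exact List.pairwise_singleton _ _
    | a :: b :: L, h => exact absurd rfl (h a b L)

end Profile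

/-! ### Motion of the fronts -/

/-- The trajectory of a front: its initial position and its speed. The lexicographic order is the
order of the fronts right after the initial time. -/
abbrev Ray := ℝ ×ₗ ℝ

/-- The position of a front after time `s`. -/
def position (s : ℝ) (k : Ray) : ℝ := (ofLex k).1 + (ofLex k).2 * s

/-- The fronts issuing from the jumps of a step function, each one keyed by its trajectory. -/
noncomputable def rays : State → List (ℝ × State) → List (Ray × State)
  | _, [] => []
  | ul, (y, u) :: L => (toLex (y, sigma ul u), u) :: rays u L

theorem evolve_eq_map_rays (ul : State) (L : List (ℝ × State)) (s : ℝ) :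
    evolve ul L s = (rays ul L).map (Prod.map (position s) id) := by
  induction L generalizing ul with
  | nil => rfl
  | cons a L ih =>
    simp only [evolve, rays, position, ih, List.map_cons, Prod.map_apply, ofLex_toLex, id]

theorem map_snd_rays (ul : State) (L : List (ℝ × State)) :
    (rays ul L).map Prod.snd = L.map Prod.snd := by
  induction L generalizing ul with
  | nil => rfl
  | cons a L ih => simp only [rays, List.map_cons, ih]

theorem map_snd_evolve (ul : State) (L : List (ℝ × State)) (s : ℝ) :
    (evolve ul L s).map Prod.snd = L.map Prod.snd := by
  rw [evolve_eq_map_rays, ← map_snd_rays ul L, List.map_map]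
  rfl

theorem rays_append (ul : State) (A B : List (ℝ × State)) :
    rays ul (A ++ B) = rays ul A ++ rays ((A.map Prod.snd).getLastD ul) B := by
  induction A generalizing ul with
  | nil => rfl
  | cons a A ih => simp only [List.cons_append, rays, ih, List.map_cons, List.getLastD_cons]

theorem continuous_position (k : Ray) : Continuous fun s => position s k := by
  unfold position
  fun_prop

theorem position_le_of_le {k k' : Ray} {s : ℝ} (hk : k ≤ k') (hs₀ : 0 ≤ s)
    (hs : (ofLex k').2 < (ofLex k).2 →
      s ≤ ((ofLex k').1 - (ofLex k).1) / ((ofLex k).2 - (ofLex k').2)) :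
    position s k ≤ position s k' := by
  have hpos : (ofLex k).1 ≤ (ofLex k').1 := (Prod.Lex.le_iff'.1 hk).1
  unfold position
  rcases lt_or_ge (ofLex k').2 (ofLex k).2 with h | h
  · have := (le_div_iff₀ (sub_pos.2 h)).1 (hs h)
    linarith
  · gcongr

theorem position_lt_of_lt {k k' : Ray} {s r : ℝ} (hk : k < k') (hs₀ : 0 < s) (hsr : s < r)
    (hr : position r k ≤ position r k') : position s k < position s k' := by
  simp only [position] at hr ⊢
  rcases Prod.Lex.lt_iff.1 hk with h | ⟨h, hspeed⟩
  · nlinarith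
  · rw [h]
    gcongr

section Rays

variable {ul : State} {L : List (ℝ × State)}

theorem isChain_position_le (hL : (rays ul L).Pairwise fun a b => a.1 ≤ b.1) {s : ℝ}
    (hs₀ : 0 ≤ s) (hs : ∀ m ∈ meetTimes ul L, s ≤ m) :
    (rays ul L).IsChain fun a b => position s a.1 ≤ position s b.1 := by
  induction ul, L using meetTimes.induct with
  | case1 ul y u y' u' L h ih =>
    obtain ⟨ha, hL⟩ := List.pairwise_cons.1 hL
    rw [meetTimes, if_pos h, List.forall_mem_cons] at hs
    exact List.isChain_cons_cons.2
      ⟨position_le_of_le (ha _ List.mem_cons_self) hs₀ fun _ => hs.1, ih hL hs.2⟩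
  | case2 ul y u y' u' L h ih =>
    obtain ⟨ha, hL⟩ := List.pairwise_cons.1 hL
    rw [meetTimes, if_neg h] at hs
    exact List.isChain_cons_cons.2
      ⟨position_le_of_le (ha _ List.mem_cons_self) hs₀ fun h' => absurd h' h, ih hL hs⟩
  | case3 L ul h =>
    match L, h with
    | [], _ => exact List.IsChain.nil
    | [a], _ => exact List.IsChain.singleton _
    | (y, u) :: (y', u') :: L, h => exact absurd rfl (h y u y' u' L)

theorem meetTimes_pos (hL : (rays ul L).Pairwise fun a b => a.1 ≤ b.1) :
    ∀ m ∈ meetTimes ul L, 0 < m := by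
  induction ul, L using meetTimes.induct with
  | case1 ul y u y' u' L h ih =>
    obtain ⟨ha, hL⟩ := List.pairwise_cons.1 hL
    have hpos : y < y' :=
      (Prod.Lex.le_iff.1 (ha _ List.mem_cons_self)).resolve_right fun h' => h'.2.not_gt h
    rw [meetTimes, if_pos h, List.forall_mem_cons]
    exact ⟨div_pos (sub_pos.2 hpos) (sub_pos.2 h), ih hL⟩
  | case2 ul y u y' u' L h ih =>
    rw [meetTimes, if_neg h]
    exact ih hL.of_cons
  | case3 L ul h =>
    match L, h with
    | [], _ => simp [meetTimes]
    | [_], _ => simp [meetTimes]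
    | (y, u) :: (y', u') :: L, h => exact absurd rfl (h y u y' u' L)

theorem minimum_meetTimes_pos (hL : (rays ul L).Pairwise fun a b => a.1 ≤ b.1) :
    (0 : WithTop ℝ) < (meetTimes ul L).minimum := by
  cases h : (meetTimes ul L).minimum with
  | top => exact WithTop.coe_lt_top 0
  | coe m => exact WithTop.coe_pos.2 (meetTimes_pos hL m (List.minimum_mem h))

theorem pairwise_position_le (hL : (rays ul L).Pairwise fun a b => a.1 ≤ b.1) {s : ℝ}
    (hs₀ : 0 ≤ s) (hs : s ≤ (meetTimes ul L).minimum) :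
    (rays ul L).Pairwise fun a b => position s a.1 ≤ position s b.1 := by
  have : IsTrans (Ray × State) fun a b => position s a.1 ≤ position s b.1 :=
    ⟨fun _ _ _ => le_trans⟩
  exact (isChain_position_le hL hs₀ fun m hm =>
    WithTop.coe_le_coe.1 (hs.trans (List.minimum_le_of_mem' hm))).pairwise

theorem pairwise_evolve_le (hL : (rays ul L).Pairwise fun a b => a.1 ≤ b.1) {s : ℝ}
    (hs₀ : 0 ≤ s) (hs : s ≤ (meetTimes ul L).minimum) :
    (evolve ul L s).Pairwise fun a b => a.1 ≤ b.1 := by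
  rw [evolve_eq_map_rays, List.pairwise_map]
  exact pairwise_position_le hL hs₀ hs

theorem position_mono (hL : (rays ul L).Pairwise fun a b => a.1 ≤ b.1) {s : ℝ}
    (hs₀ : 0 ≤ s) (hs : s ≤ (meetTimes ul L).minimum) {a b : Ray × State}
    (ha : a ∈ rays ul L) (hb : b ∈ rays ul L) (hab : a.1 ≤ b.1) :
    position s a.1 ≤ position s b.1 := by
  have h := hL.and (pairwise_position_le hL hs₀ hs)
  exact List.Pairwise.forall_of_forall_of_flip
    (R := fun a b => a.1 ≤ b.1 → position s a.1 ≤ position s b.1) (fun _ _ _ => le_rfl)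
    (h.imp fun h _ => h.2) (h.imp fun h h' => by rw [le_antisymm h' h.1]) ha hb hab

theorem position_strictMono (hL : (rays ul L).Pairwise fun a b => a.1 ≤ b.1) {s : ℝ}
    (hs₀ : 0 < s) (hs : s < (meetTimes ul L).minimum) {a b : Ray × State}
    (ha : a ∈ rays ul L) (hb : b ∈ rays ul L) (hab : a.1 < b.1) :
    position s a.1 < position s b.1 := by
  obtain ⟨r, hsr, hr⟩ : ∃ r : ℝ, s < r ∧ (r : WithTop ℝ) ≤ (meetTimes ul L).minimum := by
    cases h : (meetTimes ul L).minimum with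
    | top => exact ⟨s + 1, lt_add_one s, le_top⟩
    | coe m => exact ⟨m, WithTop.coe_lt_coe.1 (h ▸ hs), le_rfl⟩
  exact position_lt_of_lt hab hs₀ hsr (position_mono hL (hs₀.trans hsr).le hr ha hb hab.le)

end Rays

/-! ### Curves that meet -/

section Meeting

variable {P : ℝ → ℝ → Prop} {t x : ℝ}

theorem meetAt_of_continuous {f g : ℝ → ℝ} {a : ℝ} (hat : a < t) (hf : Continuous f)
    (hg : Continuous g) (hft : f t = x) (hgt : g t = x)
    (h : ∀ s ∈ Ioo a t, f s < g s ∧ P s (f s) ∧ P s (g s)) : MeetAt P t x := by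
  refine ⟨t - a, sub_pos.2 hat, f, g, hf.continuousOn, hg.continuousOn,
    (hf.tendsto' t x hft).mono_left nhdsWithin_le_nhds,
    (hg.tendsto' t x hgt).mono_left nhdsWithin_le_nhds, ?_⟩
  rwa [sub_sub_cancel]

theorem eventually_forall_apply_eq {ι : Type*} {I : Set ι} (hI : I.Finite) {f : ι → ℝ → ℝ}
    (hf : ∀ i ∈ I, Continuous (f i)) {ξ : ℝ → ℝ} (hξ : Tendsto ξ (𝓝[<] t) (𝓝 x)) :
    ∀ᶠ s in 𝓝[<] t, ∀ i ∈ I, f i s = ξ s → f i t = x := by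
  refine (eventually_all_finite hI).2 fun i hi => ?_
  by_cases hx : f i t = x
  · exact Eventually.of_forall fun _ _ => hx
  · have hlim := (((hf i hi).tendsto t).mono_left nhdsWithin_le_nhds).sub hξ
    filter_upwards [hlim.eventually_ne (sub_ne_zero.2 hx)] with s hs he
    exact absurd (sub_eq_zero.2 he) hs

theorem MeetAt.exists_ne_apply_eq {ι : Type*} {I : Set ι} (hI : I.Finite) {f : ι → ℝ → ℝ}
    (hf : ∀ i ∈ I, Continuous (f i)) (hP : ∀ᶠ s in 𝓝[<] t, ∀ y, P s y → ∃ i ∈ I, f i s = y)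
    (h : MeetAt P t x) : ∃ i ∈ I, ∃ j ∈ I, i ≠ j ∧ f i t = x ∧ f j t = x := by
  obtain ⟨δ, hδ, ξ₁, ξ₂, -, -, h₁, h₂, h⟩ := h
  have hlt : ∀ᶠ s in 𝓝[<] t, s ∈ Ioo (t - δ) t := Ioo_mem_nhdsLT (sub_lt_self t hδ)
  obtain ⟨s, hs, hsP, hs₁, hs₂⟩ := (hlt.and (hP.and
    ((eventually_forall_apply_eq hI hf h₁).and (eventually_forall_apply_eq hI hf h₂)))).exists
  obtain ⟨hξ, hP₁, hP₂⟩ := h s hs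
  obtain ⟨i, hi, hfi⟩ := hsP _ hP₁
  obtain ⟨j, hj, hfj⟩ := hsP _ hP₂
  refine ⟨i, hi, j, hj, ?_, hs₁ i hi hfi, hs₂ j hj hfj⟩
  rintro rfl
  exact hξ.ne (hfi.symm.trans hfj)

end Meeting

/-! ### Calculus -/

section Calculus

variable {f : ℝ → ℝ} {s : Set ℝ} {x : ℝ}

theorem strictConvexOn_of_hasDerivWithinAt2_pos {f' f'' : ℝ → ℝ} (hs : Convex ℝ s)
    (hf : ContinuousOn f s)
    (hf' : ∀ x ∈ interior s, HasDerivWithinAt f (f' x) (interior s) x)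
    (hf'' : ∀ x ∈ interior s, HasDerivWithinAt f' (f'' x) (interior s) x)
    (hpos : ∀ x ∈ interior s, 0 < f'' x) : StrictConvexOn ℝ s f := by
  have hderiv : EqOn (deriv f) f' (interior s) := fun x hx =>
    ((hf' x hx).hasDerivAt (isOpen_interior.mem_nhds hx)).deriv
  refine StrictMonoOn.strictConvexOn_of_deriv hs hf (StrictMonoOn.congr ?_ hderiv.symm)
  refine strictMonoOn_of_hasDerivWithinAt_pos (f' := f'') hs.interior
    (fun x hx => (hf'' x hx).continuousWithinAt) ?_ ?_ <;>
  rwa [interior_interior]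

theorem hasDerivWithinAt_mul_self (hf : DifferentiableWithinAt ℝ f s x) :
    HasDerivWithinAt (fun y => y * f y) (f x + x * derivWithin f s x) s x := by
  have h := (hasDerivWithinAt_id x s).fun_mul hf.hasDerivWithinAt
  rwa [one_mul] at h

theorem hasDerivWithinAt_add_mul_derivWithin (hs : UniqueDiffOn ℝ s) (hf : ContDiffOn ℝ 2 f s)
    (hx : x ∈ s) :
    HasDerivWithinAt (fun y => f y + y * derivWithin f s y)
      (2 * derivWithin f s x + x * iteratedDerivWithin 2 f s x) s x := by
  have hf' : ContDiffOn ℝ 1 (derivWithin f s) s := hf.derivWithin hs (by norm_num)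
  have h := (hf.differentiableOn two_ne_zero x hx).hasDerivWithinAt.add
    (hasDerivWithinAt_mul_self (hf'.differentiableOn_one x hx))
  rw [iteratedDerivWithin_succ, iteratedDerivWithin_one, two_mul, add_assoc]
  exact h

end Calculus

namespace Model

variable {M : Model}

/-! ### The constitutive functions -/

theorem Rf₂_pos : 0 < M.Rf₂ := M.Rf₁_pos.trans M.Rf₁_lt

theorem Rf₁_mem_Icc : M.Rf₁ ∈ Icc 0 M.Rf₂ := ⟨M.Rf₁_pos.le, M.Rf₁_lt.le⟩

theorem antitoneOn_vf : AntitoneOn M.vf (Icc 0 M.Rf₂) :=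
  antitoneOn_of_hasDerivWithinAt_nonpos (convex_Icc _ _) M.vf_contDiff.continuousOn
    (fun x hx => (M.vf_contDiff.differentiableOn two_ne_zero x
      (interior_subset hx)).hasDerivWithinAt.mono interior_subset)
    fun x hx => M.vf_deriv x (interior_subset hx)

theorem strictMonoOn_p : StrictMonoOn M.p (Ici M.Rf₁) :=
  strictMonoOn_of_hasDerivWithinAt_pos (convex_Ici _) M.p_contDiff.continuousOn
    (fun x hx => (M.p_contDiff.differentiableOn two_ne_zero x
      (interior_subset hx)).hasDerivWithinAt.mono interior_subset)
    fun x hx => M.p_deriv x (interior_subset hx)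

theorem strictMonoOn_mul_vf : StrictMonoOn (fun ρ => ρ * M.vf ρ) (Icc 0 M.Rf₂) :=
  strictMonoOn_of_hasDerivWithinAt_pos (convex_Icc _ _)
    (continuousOn_id.mul M.vf_contDiff.continuousOn)
    (fun x hx => (hasDerivWithinAt_mul_self (M.vf_contDiff.differentiableOn two_ne_zero x
      (interior_subset hx))).mono interior_subset)
    fun x hx => M.vf_flux x (interior_subset hx)

theorem concaveOn_mul_vf : ConcaveOn ℝ (Icc 0 M.Rf₂) fun ρ => ρ * M.vf ρ :=
  concaveOn_of_hasDerivWithinAt2_nonpos (convex_Icc _ _)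
    (continuousOn_id.mul M.vf_contDiff.continuousOn)
    (fun x hx => (hasDerivWithinAt_mul_self (M.vf_contDiff.differentiableOn two_ne_zero x
      (interior_subset hx))).mono interior_subset)
    (fun _ hx => (hasDerivWithinAt_add_mul_derivWithin (uniqueDiffOn_Icc Rf₂_pos) M.vf_contDiff
      (interior_subset hx)).mono interior_subset)
    fun x hx => M.vf_concave x (interior_subset hx)

theorem strictConvexOn_mul_p : StrictConvexOn ℝ (Ici M.Rf₁) fun ρ => ρ * M.p ρ :=
  strictConvexOn_of_hasDerivWithinAt2_pos (convex_Ici _)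
    (continuousOn_id.mul M.p_contDiff.continuousOn)
    (fun x hx => (hasDerivWithinAt_mul_self (M.p_contDiff.differentiableOn two_ne_zero x
      (interior_subset hx))).mono interior_subset)
    (fun _ hx => (hasDerivWithinAt_add_mul_derivWithin (uniqueDiffOn_Ici _) M.p_contDiff
      (interior_subset hx)).mono interior_subset)
    fun x hx => M.p_convex x (interior_subset hx)

/-! ### States and their Riemann invariants -/

theorem mk_vf_mem_Omegaf {ρ : ℝ} (hρ : ρ ∈ Icc 0 M.Rf₂) : (ρ, M.vf ρ) ∈ M.Omegaf :=
  ⟨hρ, ⟨antitoneOn_vf hρ (right_mem_Icc.2 Rf₂_pos.le) hρ.2,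
    antitoneOn_vf (left_mem_Icc.2 Rf₂_pos.le) hρ hρ.1⟩, rfl⟩

theorem Vc_lt_snd_of_mem_Omegaf {u : State} (hu : u ∈ M.Omegaf) : M.Vc < u.2 :=
  M.Vc_lt.trans_le hu.2.1.1

theorem notMem_Omegaf_of_mem_Omegac {u : State} (hu : u ∈ M.Omegac) : u ∉ M.Omegaf := fun h =>
  (Vc_lt_snd_of_mem_Omegaf h).not_ge hu.2.1.2

theorem mem_Omegac_iff_notMem_Omegaf {u : State} (hu : u ∈ M.Omega) :
    u ∈ M.Omegac ↔ u ∉ M.Omegaf :=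
  ⟨notMem_Omegaf_of_mem_Omegac, hu.resolve_left⟩

theorem pos_of_mem_Omegac {u : State} (hu : u ∈ M.Omegac) : 0 < u.1 :=
  M.Rf₁_pos.trans_le hu.1.1

theorem ext_of_mem_Omegaf {a b : State} (ha : a ∈ M.Omegaf) (hb : b ∈ M.Omegaf)
    (h : a.1 = b.1) : a = b :=
  Prod.ext h (by rw [ha.2.2, hb.2.2, h])

theorem w2_of_mem_Omegaf₁ {u : State} (hu : u ∈ M.Omegaf₁) :
    M.w2 u = M.Wc + M.vf M.Rf₁ - M.vf u.1 :=
  if_pos hu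

theorem w2_of_Rf₁_le {u : State} (hu : M.Rf₁ ≤ u.1) : M.w2 u = u.2 + M.p u.1 :=
  if_neg fun h => h.2.not_ge hu

theorem w2_le_Wc_of_mem_Omegaf₁ {u : State} (hu : u ∈ M.Omegaf₁) : M.w2 u ≤ M.Wc := by
  have := antitoneOn_vf hu.1.1 Rf₁_mem_Icc hu.2.le
  rw [w2_of_mem_Omegaf₁ hu]
  linarith

theorem w2_le_w2_of_mem_Omegaf₂ {a b : State} (ha : a ∈ M.Omegaf₂) (hb : b ∈ M.Omegaf₂)
    (h : a.1 ≤ b.1) : M.w2 a ≤ M.w2 b := by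
  rw [w2_of_Rf₁_le ha.2, w2_of_Rf₁_le hb.2, ha.1.2.2, hb.1.2.2]
  exact M.vf_add_p.monotoneOn ⟨ha.2, ha.1.1.2⟩ ⟨hb.2, hb.1.1.2⟩ h

theorem mk_vf_Rf₁_mem_Omegaf₂ : (M.Rf₁, M.vf M.Rf₁) ∈ M.Omegaf₂ :=
  ⟨mk_vf_mem_Omegaf Rf₁_mem_Icc, le_rfl⟩

theorem mk_vf_Rf₂_mem_Omegaf₂ : (M.Rf₂, M.vf M.Rf₂) ∈ M.Omegaf₂ :=
  ⟨mk_vf_mem_Omegaf (right_mem_Icc.2 Rf₂_pos.le), M.Rf₁_lt.le⟩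

theorem w2_mk_vf_Rf₁ : M.w2 (M.Rf₁, M.vf M.Rf₁) = M.Wc :=
  (w2_of_Rf₁_le le_rfl).trans (add_comm _ _)

theorem w2_mk_vf_Rf₂ : M.w2 (M.Rf₂, M.vf M.Rf₂) = M.Wmax :=
  (w2_of_Rf₁_le M.Rf₁_lt.le).trans (add_comm _ _)

theorem Wc_le_w2_of_mem_Omegaf₂ {u : State} (hu : u ∈ M.Omegaf₂) : M.Wc ≤ M.w2 u :=
  w2_mk_vf_Rf₁.ge.trans (w2_le_w2_of_mem_Omegaf₂ mk_vf_Rf₁_mem_Omegaf₂ hu hu.2)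

theorem w2_le_w2_of_mem_Omegaf {a b : State} (ha : a ∈ M.Omegaf) (hb : b ∈ M.Omegaf)
    (h : a.1 ≤ b.1) : M.w2 a ≤ M.w2 b := by
  rcases lt_or_ge b.1 M.Rf₁ with hb₁ | hb₂
  · rw [w2_of_mem_Omegaf₁ ⟨ha, h.trans_lt hb₁⟩, w2_of_mem_Omegaf₁ ⟨hb, hb₁⟩]
    exact sub_le_sub_left (antitoneOn_vf ha.1 hb.1 h) _
  · rcases lt_or_ge a.1 M.Rf₁ with ha₁ | ha₂
    · exact (w2_le_Wc_of_mem_Omegaf₁ ⟨ha, ha₁⟩).trans (Wc_le_w2_of_mem_Omegaf₂ ⟨hb, hb₂⟩)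
    · exact w2_le_w2_of_mem_Omegaf₂ ⟨ha, ha₂⟩ ⟨hb, hb₂⟩ h

theorem fst_lt_of_w2_lt {a b : State} (ha : a ∈ M.Omegaf) (hb : b ∈ M.Omegaf)
    (h : M.w2 a < M.w2 b) : a.1 < b.1 :=
  not_le.1 fun h' => (w2_le_w2_of_mem_Omegaf hb ha h').not_gt h

theorem Wmin_le_w2 {u : State} (hu : u ∈ M.Omegaf) : M.Wmin ≤ M.w2 u := by
  have hzero := mk_vf_mem_Omegaf (left_mem_Icc.2 M.Rf₂_pos.le)
  have h := w2_le_w2_of_mem_Omegaf hzero hu hu.1.1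
  rwa [w2_of_mem_Omegaf₁ ⟨hzero, M.Rf₁_pos⟩] at h

theorem w2_le_Wmax {u : State} (hu : u ∈ M.Omegaf) : M.w2 u ≤ M.Wmax :=
  (w2_le_w2_of_mem_Omegaf hu mk_vf_Rf₂_mem_Omegaf₂.1 hu.1.2).trans w2_mk_vf_Rf₂.le

theorem Wmin_le_Wc : M.Wmin ≤ M.Wc :=
  (Wmin_le_w2 mk_vf_Rf₁_mem_Omegaf₂.1).trans w2_mk_vf_Rf₁.le

theorem Wc_le_Wmax : M.Wc ≤ M.Wmax :=
  w2_mk_vf_Rf₁.ge.trans (w2_le_Wmax mk_vf_Rf₁_mem_Omegaf₂.1)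

theorem w2_mem_Icc_of_mem_Omegac {u : State} (hu : u ∈ M.Omegac) :
    M.w2 u ∈ Icc M.Wc M.Wmax := by
  rw [w2_of_Rf₁_le hu.1.1]
  exact hu.2.2

theorem exists_vf_add_p_eq {w : ℝ} (hw : w ∈ Icc M.Wc M.Wmax) :
    ∃ ρ ∈ Icc M.Rf₁ M.Rf₂, M.vf ρ + M.p ρ = w := by
  have hcont : ContinuousOn (fun ρ => M.vf ρ + M.p ρ) (Icc M.Rf₁ M.Rf₂) :=
    (M.vf_contDiff.continuousOn.mono (Icc_subset_Icc_left M.Rf₁_pos.le)).add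
      (M.p_contDiff.continuousOn.mono Icc_subset_Ici_self)
  refine intermediate_value_Icc M.Rf₁_lt.le hcont ?_
  rwa [Wc, Wmax, Vf, add_comm (M.p _), add_comm (M.p _)] at hw

theorem rhof_mem_Icc {w : ℝ} (hw : w ∈ Icc M.Wc M.Wmax) : M.rhof w ∈ Icc M.Rf₁ M.Rf₂ :=
  Function.invFunOn_mem (exists_vf_add_p_eq hw)

theorem mk_vf_rhof_mem_Omegaf₂ {w : ℝ} (hw : w ∈ Icc M.Wc M.Wmax) :
    (M.rhof w, M.vf (M.rhof w)) ∈ M.Omegaf₂ :=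
  ⟨mk_vf_mem_Omegaf (Icc_subset_Icc_left M.Rf₁_pos.le (rhof_mem_Icc hw)), (rhof_mem_Icc hw).1⟩

theorem w2_mk_vf_rhof {w : ℝ} (hw : w ∈ Icc M.Wc M.Wmax) :
    M.w2 (M.rhof w, M.vf (M.rhof w)) = w :=
  (w2_of_Rf₁_le (rhof_mem_Icc hw).1).trans
    (Function.invFunOn_eq (f := fun ρ => M.vf ρ + M.p ρ) (exists_vf_add_p_eq hw))

theorem exists_mem_Omegaf_w2_eq {w : ℝ} (hw : w ∈ Icc M.Wmin M.Wmax) :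
    ∃ u ∈ M.Omegaf, M.w2 u = w := by
  rcases le_or_gt M.Wc w with h | h
  · exact ⟨_, (mk_vf_rhof_mem_Omegaf₂ ⟨h, hw.2⟩).1, w2_mk_vf_rhof ⟨h, hw.2⟩⟩
  · have hcont : ContinuousOn M.vf (Icc 0 M.Rf₁) :=
      M.vf_contDiff.continuousOn.mono (Icc_subset_Icc_right M.Rf₁_lt.le)
    have hval : M.Wc + M.vf M.Rf₁ - w ∈ Ioc (M.vf M.Rf₁) (M.vf 0) :=
      ⟨by linarith, by linarith [show M.Wc + M.vf M.Rf₁ - M.vf 0 ≤ w from hw.1]⟩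
    obtain ⟨ρ, hρ, hρw⟩ := intermediate_value_Ico' M.Rf₁_pos.le hcont hval
    have hmem : (ρ, M.vf ρ) ∈ M.Omegaf₁ :=
      ⟨mk_vf_mem_Omegaf ⟨hρ.1, hρ.2.le.trans M.Rf₁_lt.le⟩, hρ.2⟩
    exact ⟨_, hmem.1, by rw [w2_of_mem_Omegaf₁ hmem, hρw, sub_sub_cancel]⟩

theorem freeState_mem_Omegaf {w : ℝ} (hw : w ∈ Icc M.Wmin M.Wmax) : M.freeState w ∈ M.Omegaf :=
  Function.invFunOn_mem (exists_mem_Omegaf_w2_eq hw)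

theorem w2_freeState {w : ℝ} (hw : w ∈ Icc M.Wmin M.Wmax) : M.w2 (M.freeState w) = w :=
  Function.invFunOn_eq (exists_mem_Omegaf_w2_eq hw)

theorem exists_p_eq {v w : ℝ} (hv : v ∈ Icc 0 M.Vc) (hw : w ∈ Icc M.Wc M.Wmax) :
    ∃ ρ ∈ Icc M.Rf₁ M.Rmax, M.p ρ = w - v := by
  have hvf : M.Vc < M.vf M.Rf₁ := Vc_lt_snd_of_mem_Omegaf mk_vf_Rf₁_mem_Omegaf₂.1
  refine intermediate_value_Icc M.Rmax_ge (M.p_contDiff.continuousOn.mono Icc_subset_Ici_self) ?_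
  rw [Wc, Wmax, Vf, ← M.p_Rmax] at hw
  exact ⟨by linarith [hw.1, hv.2], by linarith [hw.2, hv.1]⟩

theorem congState_mem_Omegac {v w : ℝ} (hv : v ∈ Icc 0 M.Vc) (hw : w ∈ Icc M.Wc M.Wmax) :
    M.congState v w ∈ M.Omegac := by
  refine ⟨Function.invFunOn_mem (exists_p_eq hv hw), hv, ?_⟩
  rwa [congState, pinv, Function.invFunOn_eq (exists_p_eq hv hw), add_sub_cancel]

theorem w2_congState {v w : ℝ} (hv : v ∈ Icc 0 M.Vc) (hw : w ∈ Icc M.Wc M.Wmax) :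
    M.w2 (M.congState v w) = w := by
  rw [w2_of_Rf₁_le (congState_mem_Omegac hv hw).1.1, congState, pinv,
    Function.invFunOn_eq (exists_p_eq hv hw), add_sub_cancel]

/-- The states of density at least `R_f'` with second Riemann invariant `w`. -/
def levelCurve (M : Model) (w : ℝ) : Set State := {u | M.Rf₁ ≤ u.1 ∧ M.w2 u = w}

theorem mem_levelCurve_of_mem_Omegac {u : State} (hu : u ∈ M.Omegac) :
    u ∈ M.levelCurve (M.w2 u) :=
  ⟨hu.1.1, rfl⟩

theorem snd_of_mem_levelCurve {u : State} {w : ℝ} (hu : u ∈ M.levelCurve w) :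
    u.2 = w - M.p u.1 := by
  rw [← hu.2, w2_of_Rf₁_le hu.1, add_sub_cancel_right]

theorem fst_lt_fst_iff_of_mem_levelCurve {a b : State} {w : ℝ} (ha : a ∈ M.levelCurve w)
    (hb : b ∈ M.levelCurve w) : a.1 < b.1 ↔ b.2 < a.2 := by
  rw [snd_of_mem_levelCurve ha, snd_of_mem_levelCurve hb, sub_lt_sub_iff_left,
    strictMonoOn_p.lt_iff_lt ha.1 hb.1]

theorem congState_eq {u : State} (hu : u ∈ M.Omegac) : M.congState u.2 (M.w2 u) = u := by
  have hw := w2_mem_Icc_of_mem_Omegac hu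
  have hp : M.p (M.congState u.2 (M.w2 u)).1 = M.p u.1 := by
    rw [congState, pinv, Function.invFunOn_eq (exists_p_eq hu.2.1 hw), w2_of_Rf₁_le hu.1.1,
      add_sub_cancel_left]
  exact Prod.ext (strictMonoOn_p.injOn (congState_mem_Omegac hu.2.1 hw).1.1 hu.1.1 hp) rfl

/-! ### Speeds of propagation -/

theorem sigma_eq_slope_of_mem_Omegaf {a b : State} (ha : a ∈ M.Omegaf) (hb : b ∈ M.Omegaf) :
    sigma a b = slope (fun ρ => ρ * M.vf ρ) a.1 b.1 := by
  rw [sigma, slope_def_field, ha.2.2, hb.2.2]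

theorem sigma_eq_sub_slope_of_mem_levelCurve {a b : State} {w : ℝ} (ha : a ∈ M.levelCurve w)
    (hb : b ∈ M.levelCurve w) (hab : a.1 ≠ b.1) :
    sigma a b = w - slope (fun ρ => ρ * M.p ρ) a.1 b.1 := by
  have h : b.1 - a.1 ≠ 0 := sub_ne_zero.2 hab.symm
  rw [sigma, slope_def_field, snd_of_mem_levelCurve ha, snd_of_mem_levelCurve hb]
  field_simp
  ring

theorem sigma_pos_of_mem_Omegaf {a b : State} (ha : a ∈ M.Omegaf) (hb : b ∈ M.Omegaf)
    (hab : a.1 ≠ b.1) : 0 < sigma a b := by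
  rw [sigma_eq_slope_of_mem_Omegaf ha hb]
  exact strictMonoOn_mul_vf.slope_pos ha.1 hb.1 hab

theorem sigma_le_sigma_of_mem_Omegaf {a b c : State} (ha : a ∈ M.Omegaf) (hb : b ∈ M.Omegaf)
    (hc : c ∈ M.Omegaf) (hab : b.1 < a.1) (hbc : c.1 < b.1) : sigma a b ≤ sigma b c := by
  rw [sigma_eq_slope_of_mem_Omegaf ha hb, sigma_eq_slope_of_mem_Omegaf hb hc, slope_comm,
    slope_comm _ b.1 c.1, slope_def_field, slope_def_field]
  exact concaveOn_mul_vf.slope_anti_adjacent hc.1 ha.1 hbc hab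

theorem sigma_lt_sigma_of_mem_levelCurve {a b c : State} {w : ℝ} (ha : a ∈ M.levelCurve w)
    (hb : b ∈ M.levelCurve w) (hc : c ∈ M.levelCurve w) (hab : a.2 < b.2) (hbc : b.2 < c.2) :
    sigma a b < sigma b c := by
  rw [← fst_lt_fst_iff_of_mem_levelCurve hb ha] at hab
  rw [← fst_lt_fst_iff_of_mem_levelCurve hc hb] at hbc
  rw [sigma_eq_sub_slope_of_mem_levelCurve ha hb hab.ne',
    sigma_eq_sub_slope_of_mem_levelCurve hb hc hbc.ne', slope_comm, slope_comm _ b.1 c.1,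
    slope_def_field, slope_def_field]
  exact sub_lt_sub_left (strictConvexOn_mul_p.slope_strict_mono_adjacent hc.1 ha.1 hbc hab) w

theorem sigma_neg_of_mem_levelCurve {a b : State} {w : ℝ} (ha : a ∈ M.levelCurve w)
    (hb : b ∈ M.levelCurve w) (hbf : b ∈ M.Omegaf) (hab : a.2 < b.2) : sigma a b < 0 := by
  rw [← fst_lt_fst_iff_of_mem_levelCurve hb ha] at hab
  have hslope : M.p b.1 + b.1 * derivWithin M.p (Ici M.Rf₁) b.1 ≤
      slope (fun ρ => ρ * M.p ρ) b.1 a.1 :=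
    strictConvexOn_mul_p.convexOn.le_slope_of_hasDerivWithinAt hb.1 ha.1 hab
      (hasDerivWithinAt_mul_self (M.p_contDiff.differentiableOn two_ne_zero b.1 hb.1))
  have hdrop := M.capacity_drop b.1 ⟨hb.1, hbf.1.2⟩
  rw [← hbf.2.2, snd_of_mem_levelCurve hb] at hdrop
  rw [sigma_eq_sub_slope_of_mem_levelCurve ha hb hab.ne', slope_comm]
  linarith

theorem sigma_eq_snd_of_fst_eq_zero {a b : State} (ha : a.1 = 0) (hb : b.1 ≠ 0) :
    sigma a b = b.2 := by
  rw [sigma, ha, zero_mul, sub_zero, sub_zero, mul_div_cancel_left₀ _ hb]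

theorem sigma_sub_snd {a b : State} (hab : a.1 ≠ b.1) :
    sigma a b - b.2 = a.1 * ((b.2 - a.2) / (b.1 - a.1)) := by
  have h : b.1 - a.1 ≠ 0 := sub_ne_zero.2 hab.symm
  rw [sigma]
  field_simp
  ring

theorem sigma_eq_snd_of_snd_eq {a b : State} (hv : a.2 = b.2) (hab : a ≠ b) : sigma a b = b.2 := by
  have h := sigma_sub_snd fun hρ => hab (Prod.ext hρ hv)
  rwa [hv, sub_self, zero_div, mul_zero, sub_eq_zero] at h

theorem sigma_lt_snd {a b : State} (ha : 0 < a.1) (hab : (b.2 - a.2) / (b.1 - a.1) < 0) :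
    sigma a b < b.2 := by
  have hne : a.1 ≠ b.1 := fun h => by simp [h] at hab
  rw [← sub_neg, sigma_sub_snd hne]
  exact mul_neg_of_pos_of_neg ha hab

theorem sigma_lt_snd_of_mem_levelCurve {a b : State} {w : ℝ} (ha : a ∈ M.levelCurve w)
    (hb : b ∈ M.levelCurve w) (hab : a.2 ≠ b.2) : sigma a b < b.2 := by
  refine sigma_lt_snd (M.Rf₁_pos.trans_le ha.1) ?_
  rcases hab.lt_or_gt with h | h
  · exact div_neg_of_pos_of_neg (sub_pos.2 h)
      (sub_neg.2 ((fst_lt_fst_iff_of_mem_levelCurve hb ha).2 h))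
  · exact div_neg_of_neg_of_pos (sub_neg.2 h)
      (sub_pos.2 ((fst_lt_fst_iff_of_mem_levelCurve ha hb).2 h))

end Model

/-! ### Fans -/

/-- The states following `ul` in a fan, keyed by the speeds of the fronts. -/
noncomputable def speeds : State → List State → List (ℝ × State)
  | _, [] => []
  | ul, u :: S => (sigma ul u, u) :: speeds u S

theorem map_snd_speeds (ul : State) (S : List State) : (speeds ul S).map Prod.snd = S := by
  induction S generalizing ul with
  | nil => rfl
  | cons u S ih => simp only [speeds, List.map_cons, ih]

theorem speeds_append (ul : State) (A B : List State) :
    speeds ul (A ++ B) = speeds ul A ++ speeds (A.getLastD ul) B := by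
  induction A generalizing ul with
  | nil => rfl
  | cons a A ih => simp only [List.cons_append, speeds, ih, List.getLastD_cons]

theorem exists_of_mem_speeds {q : State → State → Prop} {ul : State} {S : List State}
    (hq : (ul :: S).Pairwise q) {e : ℝ × State} (he : e ∈ speeds ul S) :
    ∃ a ∈ ul :: S, e.2 ∈ S ∧ q a e.2 ∧ e.1 = sigma a e.2 := by
  induction S generalizing ul with
  | nil => simp [speeds] at he
  | cons u S ih =>
    rcases List.mem_cons.1 he with rfl | he
    · exact ⟨ul, List.mem_cons_self, List.mem_cons_self,
        List.rel_of_pairwise_cons hq List.mem_cons_self, rfl⟩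
    · obtain ⟨a, ha, hb, h⟩ := ih hq.of_cons he
      exact ⟨a, List.mem_cons_of_mem _ ha, List.mem_cons_of_mem _ hb, h⟩

theorem pairwise_speeds {r : ℝ → ℝ → Prop} [IsTrans ℝ r] {q : State → State → Prop}
    {X : Set State} (hX : ∀ a ∈ X, ∀ b ∈ X, ∀ c ∈ X, q a b → q b c → r (sigma a b) (sigma b c))
    {ul : State} {S : List State} (hS : ∀ u ∈ ul :: S, u ∈ X) (hq : (ul :: S).Pairwise q) :
    (speeds ul S).Pairwise fun a b => r a.1 b.1 := by
  have : IsTrans (ℝ × State) fun a b => r a.1 b.1 := ⟨fun _ _ _ => _root_.trans⟩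
  refine List.IsChain.pairwise ?_
  induction S generalizing ul with
  | nil => exact List.IsChain.nil
  | cons u S ih =>
    have ih := ih (fun v hv => hS v (List.mem_cons_of_mem _ hv)) hq.of_cons
    cases S with
    | nil => exact List.IsChain.singleton _
    | cons u' S =>
      simp only [List.mem_cons, forall_eq_or_imp] at hS
      exact List.isChain_cons_cons.2 ⟨hX _ hS.1 _ hS.2.1 _ hS.2.2.1
        (List.rel_of_pairwise_cons hq List.mem_cons_self)
        (List.rel_of_pairwise_cons hq.of_cons List.mem_cons_self), ih⟩

theorem crossings_eq_nil {K α : Type*} {F : Set α} {d : α} {L : List (K × α)}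
    (h : ∀ u ∈ L.map Prod.snd, u ∈ F ↔ d ∈ F) : crossings F d L = [] := by
  induction L generalizing d with
  | nil => rfl
  | cons a L ih =>
    rw [List.map_cons, List.forall_mem_cons] at h
    rw [crossings, if_pos h.1.symm]
    exact ih fun u hu => (h.2 u hu).trans h.1.symm

theorem odd_length_crossings {K α : Type*} {F : Set α} {d : α} {L : List (K × α)} :
    Odd (crossings F d L).length ↔ ¬ (d ∈ F ↔ (L.map Prod.snd).getLastD d ∈ F) := by
  induction L generalizing d with
  | nil => simp [crossings]
  | cons a L ih =>
    rw [crossings, List.map_cons, List.getLastD_cons]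
    split_ifs with h
    · rw [ih, h]
    · rw [List.length_cons, Nat.odd_add_one, ih]
      tauto

namespace Model

/-- The states differ, and a change of phase is one of the admissible phase transitions. -/
def AdmissibleJump (M : Model) (a b : State) : Prop :=
  a ≠ b ∧ (¬ (a ∈ M.Omegaf ↔ b ∈ M.Omegaf) → (a, b) ∈ M.Ge)

theorem AdmissibleJump.of_same_phase {M : Model} {a b : State} (hab : a ≠ b)
    (h : a ∈ M.Omegaf ↔ b ∈ M.Omegaf) : M.AdmissibleJump a b :=
  ⟨hab, fun hF => absurd h hF⟩

/-- The states `S` following `ul` form an admissible solution of the Riemann problem with data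
`ul` and `ur`. The fronts are not required to have distinct speeds: fronts of the same speed form a
single jump, and only the jumps are required to be admissible. -/
structure IsFan (M : Model) (ul : State) (S : List State) (ur : State) : Prop where
  mem_Omega : ∀ u ∈ S, u ∈ M.Omega
  getLastD_eq : S.getLastD ul = ur
  pairwise_le : (speeds ul S).Pairwise fun a b => a.1 ≤ b.1
  admissible : JumpsSatisfy M.AdmissibleJump ul (speeds ul S)
  length_crossings_le : (crossings M.Omegaf ul (speeds ul S)).length ≤ 1

variable {M : Model} {ul um ur : State} {A B S : List State}

namespace IsFan

open Classical in
theorem length_crossings (h : M.IsFan ul S ur) :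
    (crossings M.Omegaf ul (speeds ul S)).length =
      if (ul ∈ M.Omegaf ↔ ur ∈ M.Omegaf) then 0 else 1 := by
  have hodd := odd_length_crossings (F := M.Omegaf) (d := ul) (L := speeds ul S)
  rw [map_snd_speeds, h.getLastD_eq] at hodd
  split_ifs with hF
  · exact Nat.lt_one_iff.1 (h.length_crossings_le.lt_of_ne fun h1 => hodd.1 (h1 ▸ odd_one) hF)
  · exact h.length_crossings_le.antisymm (hodd.2 hF).pos

theorem append (hA : M.IsFan ul A um) (hB : M.IsFan um B ur)
    (hF : (ul ∈ M.Omegaf ↔ um ∈ M.Omegaf) ∨ (um ∈ M.Omegaf ↔ ur ∈ M.Omegaf))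
    (hAB : ∀ a ∈ speeds ul A, ∀ b ∈ speeds um B, a.1 < b.1) : M.IsFan ul (A ++ B) ur where
  mem_Omega := List.forall_mem_append.2 ⟨hA.mem_Omega, hB.mem_Omega⟩
  getLastD_eq := by rw [getLastD_append, hA.getLastD_eq, hB.getLastD_eq]
  pairwise_le := by
    rw [speeds_append, hA.getLastD_eq, List.pairwise_append]
    exact ⟨hA.pairwise_le, hB.pairwise_le, fun a ha b hb => (hAB a ha b hb).le⟩
  admissible := by
    rw [speeds_append, hA.getLastD_eq]
    refine hA.admissible.append hAB ?_
    rw [map_snd_speeds, hA.getLastD_eq]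
    exact hB.admissible
  length_crossings_le := by
    rw [speeds_append, crossings_append, map_snd_speeds, hA.getLastD_eq, List.length_append,
      hA.length_crossings, hB.length_crossings]
    split_ifs <;> tauto

theorem of_pairwise (hΩ : ∀ u ∈ S, u ∈ M.Omega) (hlast : S.getLastD ul = ur)
    (hle : (speeds ul S).Pairwise fun a b => a.1 ≤ b.1)
    (hadm : (ul :: S).Pairwise M.AdmissibleJump)
    (hlen : (crossings M.Omegaf ul (speeds ul S)).length ≤ 1) : M.IsFan ul S ur where
  mem_Omega := hΩ
  getLastD_eq := hlast
  pairwise_le := hle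
  admissible := .of_pairwise hle (by rwa [map_snd_speeds])
  length_crossings_le := hlen

theorem of_same_phase (hΩ : ∀ u ∈ S, u ∈ M.Omega) (hF : ∀ u ∈ S, u ∈ M.Omegaf ↔ ul ∈ M.Omegaf)
    (hlast : S.getLastD ul = ur) (hle : (speeds ul S).Pairwise fun a b => a.1 ≤ b.1)
    (hne : (ul :: S).Pairwise (· ≠ ·)) : M.IsFan ul S ur := by
  have hF' : ∀ u ∈ ul :: S, u ∈ M.Omegaf ↔ ul ∈ M.Omegaf := List.forall_mem_cons.2 ⟨Iff.rfl, hF⟩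
  refine of_pairwise hΩ hlast hle (hne.imp_of_mem fun ha hb hab =>
    .of_same_phase hab ((hF' _ ha).trans (hF' _ hb).symm)) ?_
  rw [crossings_eq_nil (by rwa [map_snd_speeds])]
  exact zero_le_one

theorem nil (ul : State) : M.IsFan ul [] ul :=
  of_same_phase (by simp) (by simp) rfl List.Pairwise.nil (List.pairwise_singleton _ _)

theorem singleton (hr : ur ∈ M.Omega) (h : M.AdmissibleJump ul ur) : M.IsFan ul [ur] ur :=
  of_pairwise (by simpa using hr) rfl (List.pairwise_singleton _ _) (by simpa using h)
    ((crossings_sublist _ _ _).length_le.trans (by simp [speeds]))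

end IsFan

/-! ### Discretized rarefactions -/

/-- The points of the progression `a + e, a + 2 e, …` that lie before `b`, except that the last one
is omitted if the step `e` does not divide `b - a`, as in `freeWave` and `firstWave`. -/
noncomputable def discretization (a b e : ℝ) : List ℝ :=
  (List.range (⌊(b - a) / e⌋₊ - 1)).map fun i => a + (i + 1 : ℕ) * e

theorem mem_Ioo_of_mem_discretization {a b e t : ℝ} (he : 0 ≤ e)
    (ht : t ∈ discretization a b e) : t ∈ Ioo a b := by
  obtain ⟨i, hi, rfl⟩ := List.mem_map.1 ht
  have hi : i + 2 ≤ ⌊(b - a) / e⌋₊ := by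
    have := List.mem_range.1 hi
    lia
  have hpos : 0 < e := he.lt_of_ne fun h => by simp [← h] at hi
  have hle := (le_div_iff₀ hpos).1 ((Nat.le_floor_iff' (Nat.succ_ne_zero _)).1 hi)
  push_cast at hle ⊢
  constructor <;> nlinarith

theorem pairwise_lt_discretization (a b : ℝ) {e : ℝ} (he : 0 ≤ e) :
    (discretization a b e).Pairwise (· < ·) := by
  rcases he.eq_or_lt with rfl | he
  · simp [discretization]
  · refine List.pairwise_map.2 (List.pairwise_lt_range.imp fun hij => ?_)
    gcongr

theorem pairwise_rarefaction {α : Type*} {q : α → α → Prop} {X : Set α} {g : α → ℝ} {F : ℝ → α}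
    {a b : α} {e : ℝ} (he : 0 ≤ e) (hq : ∀ u ∈ X, ∀ v ∈ X, g u < g v → q u v)
    (hF : ∀ t ∈ Ioo (g a) (g b), F t ∈ X ∧ g (F t) = t) (ha : a ∈ X) (hb : b ∈ X) (hab : q a b) :
    (a :: ((discretization (g a) (g b) e).map F ++ [b])).Pairwise q := by
  have hIoo : ∀ t ∈ discretization (g a) (g b) e, t ∈ Ioo (g a) (g b) := fun t =>
    mem_Ioo_of_mem_discretization he
  refine List.pairwise_cons.2 ⟨List.forall_mem_append.2 ⟨List.forall_mem_map.2 fun t ht => ?_,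
    by simpa using hab⟩, List.pairwise_append.2 ⟨List.pairwise_map.2 <|
    (pairwise_lt_discretization _ _ he).imp_of_mem fun {s t} hs ht hst => ?_,
    List.pairwise_singleton _ _, List.forall_mem_map.2 fun t ht => ?_⟩⟩
  · obtain ⟨hX, hg⟩ := hF t (hIoo t ht)
    exact hq _ ha _ hX (hg.symm ▸ (hIoo t ht).1)
  · obtain ⟨hX, hg⟩ := hF s (hIoo s hs)
    obtain ⟨hX', hg'⟩ := hF t (hIoo t ht)
    exact hq _ hX _ hX' (by rwa [hg, hg'])
  · obtain ⟨hX, hg⟩ := hF t (hIoo t ht)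
    simpa using hq _ hX _ hb (hg.symm ▸ (hIoo t ht).2)

theorem forall_mem_rarefaction {α : Type*} {X : Set α} {F : ℝ → α} {a b e : ℝ} (he : 0 ≤ e)
    (hF : ∀ t ∈ Ioo a b, F t ∈ X) : ∀ u ∈ (discretization a b e).map F, u ∈ X :=
  List.forall_mem_map.2 fun t ht => hF t (mem_Ioo_of_mem_discretization he ht)

section FreeWave

variable {n : ℕ}

theorem epsw_nonneg (n : ℕ) : 0 ≤ M.epsw n := div_nonneg (sub_nonneg.2 Wmin_le_Wc) (by positivity)

theorem freeWave_of_fst_lt (h : ul.1 < ur.1) : M.freeWave n ul ur = [ur] := by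
  rw [freeWave, if_neg (ne_of_apply_ne Prod.fst h.ne), if_neg h.not_gt]

theorem freeWave_of_lt_fst (h : ur.1 < ul.1) :
    M.freeWave n ul ur = (discretization (-M.w2 ul) (-M.w2 ur) (M.epsw n)).map
      (fun t => M.freeState (-t)) ++ [ur] := by
  rw [freeWave, if_neg (ne_of_apply_ne Prod.fst h.ne'), if_pos h, discretization, List.map_map,
    neg_sub_neg]
  simp only [Function.comp_def, neg_add, neg_neg, ← sub_eq_add_neg]

theorem freeWave_self : M.freeWave n ul ul = [] := if_pos rfl

theorem getLastD_freeWave : (M.freeWave n ul ur).getLastD ul = ur := by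
  rw [freeWave]
  split_ifs with h
  · exact h
  · rw [List.getLastD_concat]
  · rfl

theorem freeState_neg_mem_Omegaf (hl : ul ∈ M.Omegaf) (hr : ur ∈ M.Omegaf) {t : ℝ}
    (ht : t ∈ Ioo (-M.w2 ul) (-M.w2 ur)) :
    M.freeState (-t) ∈ M.Omegaf ∧ -M.w2 (M.freeState (-t)) = t := by
  have hw : -t ∈ Icc M.Wmin M.Wmax :=
    ⟨(Wmin_le_w2 hr).trans (le_neg.1 ht.2.le), (neg_le.1 ht.1.le).trans (w2_le_Wmax hl)⟩
  exact ⟨freeState_mem_Omegaf hw, by rw [w2_freeState hw, neg_neg]⟩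

theorem mem_Omegaf_of_mem_freeWave (hl : ul ∈ M.Omegaf) (hr : ur ∈ M.Omegaf) :
    ∀ u ∈ M.freeWave n ul ur, u ∈ M.Omegaf := by
  rcases lt_trichotomy ul.1 ur.1 with h | h | h
  · rw [freeWave_of_fst_lt h]
    exact List.forall_mem_singleton.2 hr
  · rw [ext_of_mem_Omegaf hl hr h, freeWave_self]
    exact List.forall_mem_nil _
  · rw [freeWave_of_lt_fst h]
    exact List.forall_mem_append.2 ⟨forall_mem_rarefaction (epsw_nonneg n) fun t ht =>
      (freeState_neg_mem_Omegaf hl hr ht).1, List.forall_mem_singleton.2 hr⟩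

theorem pairwise_fst_lt_freeWave (hl : ul ∈ M.Omegaf) (hr : ur ∈ M.Omegaf) (h : ur.1 < ul.1) :
    (ul :: M.freeWave n ul ur).Pairwise fun a b => b.1 < a.1 := by
  rw [freeWave_of_lt_fst h]
  exact pairwise_rarefaction (g := fun u => -M.w2 u) (epsw_nonneg n)
    (fun u hu v hv huv => fst_lt_of_w2_lt hv hu (neg_lt_neg_iff.1 huv))
    (fun t => freeState_neg_mem_Omegaf hl hr) hl hr h

theorem pairwise_fst_ne_freeWave (hl : ul ∈ M.Omegaf) (hr : ur ∈ M.Omegaf) :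
    (ul :: M.freeWave n ul ur).Pairwise fun a b => a.1 ≠ b.1 := by
  rcases lt_trichotomy ul.1 ur.1 with h | h | h
  · rw [freeWave_of_fst_lt h]
    exact List.pairwise_pair.2 h.ne
  · rw [ext_of_mem_Omegaf hl hr h, freeWave_self]
    exact List.pairwise_singleton _ _
  · exact (pairwise_fst_lt_freeWave hl hr h).imp ne_of_gt

theorem isFan_freeWave (hl : ul ∈ M.Omegaf) (hr : ur ∈ M.Omegaf) :
    M.IsFan ul (M.freeWave n ul ur) ur := by
  have hmem := mem_Omegaf_of_mem_freeWave (n := n) hl hr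
  refine .of_same_phase (fun u hu => Or.inl (hmem u hu)) (fun u hu => iff_of_true (hmem u hu) hl)
    getLastD_freeWave ?_ ((pairwise_fst_ne_freeWave hl hr).imp (ne_of_apply_ne Prod.fst))
  rcases lt_or_ge ur.1 ul.1 with h | h
  · exact pairwise_speeds (fun a ha b hb c hc => sigma_le_sigma_of_mem_Omegaf ha hb hc)
      (List.forall_mem_cons.2 ⟨hl, hmem⟩) (pairwise_fst_lt_freeWave hl hr h)
  · rcases h.lt_or_eq with h | h
    · rw [freeWave_of_fst_lt h]
      exact List.pairwise_singleton _ _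
    · rw [ext_of_mem_Omegaf hl hr h, freeWave_self]
      exact List.Pairwise.nil

theorem speeds_freeWave_pos (hl : ul ∈ M.Omegaf) (hr : ur ∈ M.Omegaf) :
    ∀ e ∈ speeds ul (M.freeWave n ul ur), 0 < e.1 := by
  intro e he
  have hmem := mem_Omegaf_of_mem_freeWave (n := n) hl hr
  obtain ⟨a, ha, hb, hab, hσ⟩ := exists_of_mem_speeds (pairwise_fst_ne_freeWave hl hr) he
  rw [hσ]
  exact sigma_pos_of_mem_Omegaf (List.forall_mem_cons.2 ⟨hl, hmem⟩ a ha) (hmem _ hb) hab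

end FreeWave

section FirstWave

variable {n : ℕ} {v : ℝ}

theorem epsv_nonneg (n : ℕ) : 0 ≤ M.epsv n := div_nonneg M.Vc_pos.le (by positivity)

theorem firstWave_of_lt (h : ul.2 < v) :
    M.firstWave n ul v = (discretization ul.2 v (M.epsv n)).map
      (fun t => M.congState t (M.w2 ul)) ++ [M.congState v (M.w2 ul)] := by
  rw [firstWave, if_neg h.ne, if_pos h, discretization, List.map_map]
  rfl

theorem firstWave_of_gt (h : v < ul.2) : M.firstWave n ul v = [M.congState v (M.w2 ul)] := by
  rw [firstWave, if_neg h.ne', if_neg h.not_gt]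

theorem firstWave_snd : M.firstWave n ul ul.2 = [] := if_pos rfl

theorem getLastD_firstWave (hl : ul ∈ M.Omegac) :
    (M.firstWave n ul v).getLastD ul = M.congState v (M.w2 ul) := by
  rw [firstWave]
  split_ifs with h
  · rw [← h, congState_eq hl]
    rfl
  · rw [List.getLastD_concat]
  · rfl

theorem congState_mem_inter (hl : ul ∈ M.Omegac) (hv : v ∈ Icc 0 M.Vc) :
    M.congState v (M.w2 ul) ∈ M.Omegac ∩ M.levelCurve (M.w2 ul) := by
  have hw := w2_mem_Icc_of_mem_Omegac hl
  have hm := congState_mem_Omegac hv hw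
  exact ⟨hm, hm.1.1, w2_congState hv hw⟩

theorem congState_mem_inter_of_mem_Ioo (hl : ul ∈ M.Omegac) (hv : v ∈ Icc 0 M.Vc) {t : ℝ}
    (ht : t ∈ Ioo ul.2 v) :
    M.congState t (M.w2 ul) ∈ M.Omegac ∩ M.levelCurve (M.w2 ul) :=
  congState_mem_inter hl ⟨hl.2.1.1.trans ht.1.le, ht.2.le.trans hv.2⟩

theorem mem_inter_of_mem_firstWave (hl : ul ∈ M.Omegac) (hv : v ∈ Icc 0 M.Vc) :
    ∀ u ∈ ul :: M.firstWave n ul v, u ∈ M.Omegac ∩ M.levelCurve (M.w2 ul) := by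
  refine List.forall_mem_cons.2 ⟨⟨hl, mem_levelCurve_of_mem_Omegac hl⟩, ?_⟩
  rcases lt_trichotomy ul.2 v with h | rfl | h
  · rw [firstWave_of_lt h]
    exact List.forall_mem_append.2 ⟨forall_mem_rarefaction (epsv_nonneg n) fun t =>
      congState_mem_inter_of_mem_Ioo hl hv, List.forall_mem_singleton.2 (congState_mem_inter hl hv)⟩
  · rw [firstWave_snd]
    exact List.forall_mem_nil _
  · rw [firstWave_of_gt h]
    exact List.forall_mem_singleton.2 (congState_mem_inter hl hv)

theorem pairwise_snd_lt_firstWave (hl : ul ∈ M.Omegac) (hv : v ∈ Icc 0 M.Vc) (h : ul.2 ≤ v) :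
    (ul :: M.firstWave n ul v).Pairwise fun a b => a.2 < b.2 := by
  rcases h.eq_or_lt with rfl | h
  · rw [firstWave_snd]
    exact List.pairwise_singleton _ _
  · rw [firstWave_of_lt h]
    exact pairwise_rarefaction (X := M.Omegac ∩ M.levelCurve (M.w2 ul)) (g := Prod.snd)
      (b := M.congState v (M.w2 ul)) (epsv_nonneg n) (fun _ _ _ _ => id)
      (fun t ht => ⟨congState_mem_inter_of_mem_Ioo hl hv ht, rfl⟩)
      ⟨hl, mem_levelCurve_of_mem_Omegac hl⟩ (congState_mem_inter hl hv) h

theorem pairwise_snd_ne_firstWave (hl : ul ∈ M.Omegac) (hv : v ∈ Icc 0 M.Vc) :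
    (ul :: M.firstWave n ul v).Pairwise fun a b => a.2 ≠ b.2 := by
  rcases le_or_gt ul.2 v with h | h
  · exact (pairwise_snd_lt_firstWave hl hv h).imp ne_of_lt
  · rw [firstWave_of_gt h]
    exact List.pairwise_pair.2 h.ne'

theorem snd_le_of_mem_firstWave (hl : ul ∈ M.Omegac) (hv : v ∈ Icc 0 M.Vc) :
    ∀ u ∈ M.firstWave n ul v, u.2 ≤ v := by
  rcases le_or_gt ul.2 v with h | h
  · intro u hu
    have hp := (pairwise_snd_lt_firstWave (n := n) hl hv h).of_cons.imp le_of_lt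
    have hlast := getLastD_firstWave (n := n) (v := v) hl
    rw [List.getLastD_eq_getLast?, List.getLast?_eq_getLast_of_ne_nil (List.ne_nil_of_mem hu),
      Option.getD_some] at hlast
    exact (hp.rel_getLast hu).trans_eq (congrArg Prod.snd hlast)
  · rw [firstWave_of_gt h]
    exact List.forall_mem_singleton.2 le_rfl

theorem pairwise_speeds_of_levelCurve {w : ℝ} (hS : ∀ u ∈ ul :: S, u ∈ M.levelCurve w)
    (hlt : (ul :: S).Pairwise fun a b => a.2 < b.2) :
    (speeds ul S).Pairwise fun a b => a.1 < b.1 :=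
  pairwise_speeds (fun _ ha _ hb _ hc => sigma_lt_sigma_of_mem_levelCurve ha hb hc) hS hlt

theorem isFan_firstWave (hl : ul ∈ M.Omegac) (hv : v ∈ Icc 0 M.Vc) :
    M.IsFan ul (M.firstWave n ul v) (M.congState v (M.w2 ul)) := by
  have hmem := mem_inter_of_mem_firstWave (n := n) hl hv
  refine .of_same_phase (fun u hu => Or.inr (hmem u (List.mem_cons_of_mem _ hu)).1)
    (fun u hu => iff_of_false (notMem_Omegaf_of_mem_Omegac (hmem u (List.mem_cons_of_mem _ hu)).1)
      (notMem_Omegaf_of_mem_Omegac hl)) (getLastD_firstWave hl) ?_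
    ((pairwise_snd_ne_firstWave hl hv).imp (ne_of_apply_ne Prod.snd))
  rcases le_or_gt ul.2 v with h | h
  · exact (pairwise_speeds_of_levelCurve (fun u hu => (hmem u hu).2)
      (pairwise_snd_lt_firstWave hl hv h)).imp le_of_lt
  · rw [firstWave_of_gt h]
    exact List.pairwise_singleton _ _

theorem speeds_firstWave_lt (hl : ul ∈ M.Omegac) (hv : v ∈ Icc 0 M.Vc) :
    ∀ e ∈ speeds ul (M.firstWave n ul v), e.1 < v := by
  intro e he
  have hmem := mem_inter_of_mem_firstWave (n := n) hl hv
  obtain ⟨a, ha, hb, hab, hσ⟩ := exists_of_mem_speeds (pairwise_snd_ne_firstWave hl hv) he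
  rw [hσ]
  exact (sigma_lt_snd_of_mem_levelCurve (hmem a ha).2 (hmem _ (List.mem_cons_of_mem _ hb)).2
    hab).trans_le (snd_le_of_mem_firstWave hl hv _ hb)

end FirstWave

theorem isFan_contact (hm : um ∈ M.Omegac) (hr : ur ∈ M.Omegac) :
    M.IsFan um (contact um ur) ur := by
  rw [contact]
  split_ifs with h
  · rw [h]
    exact .nil _
  · exact .singleton (Or.inr hr) (.of_same_phase h
      (iff_of_false (notMem_Omegaf_of_mem_Omegac hm) (notMem_Omegaf_of_mem_Omegac hr)))

theorem speeds_contact (hv : um.2 = ur.2) : ∀ e ∈ speeds um (contact um ur), e.1 = ur.2 := by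
  rw [contact]
  split_ifs with h
  · exact List.forall_mem_nil _
  · exact List.forall_mem_singleton.2 (sigma_eq_snd_of_snd_eq hv h)

/-! ### The approximate Riemann solver -/

theorem isFan_congested (n : ℕ) (hl : ul ∈ M.Omegac) (hr : ur ∈ M.Omegac) :
    M.IsFan ul (M.firstWave n ul ur.2 ++ contact (M.congState ur.2 (M.w2 ul)) ur) ur := by
  have hm := (congState_mem_inter hl hr.2.1).1
  refine (isFan_firstWave hl hr.2.1).append (isFan_contact hm hr) (Or.inr (iff_of_false
    (notMem_Omegaf_of_mem_Omegac hm) (notMem_Omegaf_of_mem_Omegac hr))) fun a ha b hb => ?_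
  rw [speeds_contact (um := M.congState ur.2 (M.w2 ul)) (ur := ur) rfl b hb]
  exact speeds_firstWave_lt hl hr.2.1 a ha

theorem admissibleJump_of_vacuum (h : ul.1 = 0) (hl : ul ∈ M.Omegaf) (hr : ur ∈ M.Omegac) :
    M.AdmissibleJump ul ur := by
  refine ⟨fun he => notMem_Omegaf_of_mem_Omegac hr (he ▸ hl), fun _ =>
    Or.inl (Or.inl ⟨⟨hl, h ▸ M.Rf₁_pos⟩, hr, ?_⟩)⟩
  rw [h, mul_zero]

theorem admissibleJump_congState_and_lt (hl : ul ∈ M.Omegaf) {v : ℝ} (hv : v ∈ Icc 0 M.Vc) :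
    M.AdmissibleJump ul (M.congState v (max M.Wc (M.w2 ul))) ∧
      ul.1 < (M.congState v (max M.Wc (M.w2 ul))).1 := by
  have hw : max M.Wc (M.w2 ul) ∈ Icc M.Wc M.Wmax :=
    ⟨le_max_left _ _, max_le Wc_le_Wmax (w2_le_Wmax hl)⟩
  have hm := congState_mem_Omegac hv hw
  have hwm := w2_congState hv hw
  have hne : ul ≠ M.congState v (max M.Wc (M.w2 ul)) := fun he =>
    notMem_Omegaf_of_mem_Omegac (he ▸ hm) hl
  rcases lt_or_ge ul.1 M.Rf₁ with h | h
  · refine ⟨⟨hne, fun _ => Or.inl (Or.inl ⟨⟨hl, h⟩, hm, ?_⟩)⟩, h.trans_le hm.1.1⟩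
    rw [hwm, max_eq_left (w2_le_Wc_of_mem_Omegaf₁ ⟨hl, h⟩), sub_self, zero_mul]
  · have hl₂ : ul ∈ M.Omegaf₂ := ⟨hl, h⟩
    rw [max_eq_right (Wc_le_w2_of_mem_Omegaf₂ hl₂)] at hwm hm hne ⊢
    exact ⟨⟨hne, fun _ => Or.inl (Or.inr ⟨hl₂, hm, hwm.symm⟩)⟩,
      (fst_lt_fst_iff_of_mem_levelCurve ⟨h, rfl⟩ ⟨hm.1.1, hwm⟩).2
        (hv.2.trans_lt (Vc_lt_snd_of_mem_Omegaf hl))⟩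

theorem isFan_freeToCongested (hl : ul ∈ M.Omegaf) (hr : ur ∈ M.Omegac) :
    M.IsFan ul (M.congState ur.2 (max M.Wc (M.w2 ul)) ::
      contact (M.congState ur.2 (max M.Wc (M.w2 ul))) ur) ur := by
  obtain ⟨hadm, hlt⟩ := admissibleJump_congState_and_lt hl hr.2.1
  have hm : M.congState ur.2 (max M.Wc (M.w2 ul)) ∈ M.Omegac := congState_mem_Omegac hr.2.1
    ⟨le_max_left _ _, max_le Wc_le_Wmax (w2_le_Wmax hl)⟩
  have hvm : (M.congState ur.2 (max M.Wc (M.w2 ul))).2 = ur.2 := rfl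
  generalize M.congState ur.2 (max M.Wc (M.w2 ul)) = um at hadm hlt hm hvm ⊢
  have hfan : M.IsFan ul [um] um := .singleton (Or.inr hm) hadm
  have hF : um ∈ M.Omegaf ↔ ur ∈ M.Omegaf :=
    iff_of_false (notMem_Omegaf_of_mem_Omegac hm) (notMem_Omegaf_of_mem_Omegac hr)
  have hcontact := isFan_contact hm hr
  rcases hl.1.1.eq_or_lt' with h | h
  · -- From the vacuum both fronts have the speed of `ur`, and form a single jump to `ur`.
    rw [contact] at hcontact ⊢
    split_ifs at hcontact ⊢ with he
    · rwa [← he]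
    · have hσ : sigma ul um = sigma um ur := by
        rw [sigma_eq_snd_of_fst_eq_zero h (pos_of_mem_Omegac hm).ne', hvm,
          sigma_eq_snd_of_snd_eq hvm he]
      refine .of_pairwise (by simp [Omega, hm, hr]) rfl (by simp [speeds, hσ]) ?_ ?_
      · simp [hadm, admissibleJump_of_vacuum h hl hr, AdmissibleJump.of_same_phase he hF]
      · simp only [speeds, crossings, hF, if_true]
        split_ifs <;> simp
  · refine hfan.append hcontact (Or.inr hF) fun a ha b hb => ?_
    rw [speeds_contact hvm b hb, List.mem_singleton.1 ha]
    rw [← hvm]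
    exact sigma_lt_snd h (div_neg_of_neg_of_pos
      (sub_neg.2 (hvm ▸ hr.2.1.2.trans_lt (Vc_lt_snd_of_mem_Omegaf hl))) (sub_pos.2 hlt))

theorem isFan_firstWave_append_singleton (n : ℕ) (hl : ul ∈ M.Omegac) (hr : ur ∈ M.Omegaf₂)
    (hw : M.w2 ur = M.w2 ul) :
    M.IsFan ul (M.firstWave n ul M.Vc ++ [ur]) ur ∧
      ∀ a ∈ speeds ul (M.firstWave n ul M.Vc ++ [ur]), a.1 < 0 := by
  have hVc : M.Vc ∈ Icc 0 M.Vc := right_mem_Icc.2 M.Vc_pos.le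
  have hA := isFan_firstWave (n := n) hl hVc
  have hAmem := mem_inter_of_mem_firstWave (n := n) hl hVc
  obtain ⟨hm, hml⟩ := congState_mem_inter hl hVc
  have hrl : ur ∈ M.levelCurve (M.w2 ul) := ⟨hr.2, hw⟩
  have hVcr := Vc_lt_snd_of_mem_Omegaf hr.1
  have hjump : M.AdmissibleJump (M.congState M.Vc (M.w2 ul)) ur :=
    ⟨fun he => notMem_Omegaf_of_mem_Omegac (he ▸ hm) hr.1,
      fun _ => Or.inr ⟨hm, hr, hml.2.trans hw.symm, rfl⟩⟩
  have hspeeds : (speeds ul (M.firstWave n ul M.Vc ++ [ur])).Pairwise fun a b => a.1 < b.1 := by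
    refine pairwise_speeds_of_levelCurve (M := M) (w := M.w2 ul) ?_ ?_ <;> rw [← List.cons_append]
    · exact List.forall_mem_append.2 ⟨fun u hu => (hAmem u hu).2, List.forall_mem_singleton.2 hrl⟩
    · exact List.pairwise_append.2 ⟨pairwise_snd_lt_firstWave hl hVc hl.2.1.2,
        List.pairwise_singleton _ _, fun a ha =>
          List.forall_mem_singleton.2 ((hAmem a ha).1.2.1.2.trans_lt hVcr)⟩
  rw [speeds_append, hA.getLastD_eq] at hspeeds ⊢
  have hlt := (List.pairwise_append.1 hspeeds).2.2
  have hneg := sigma_neg_of_mem_levelCurve hml hrl hr.1 hVcr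
  exact ⟨hA.append (.singleton (Or.inl hr.1) hjump) (Or.inl (iff_of_false
      (notMem_Omegaf_of_mem_Omegac hl) (notMem_Omegaf_of_mem_Omegac hm))) hlt,
    List.forall_mem_append.2 ⟨fun a ha => (hlt a ha _ List.mem_cons_self).trans hneg,
      List.forall_mem_singleton.2 hneg⟩⟩

theorem isFan_congestedToFree (n : ℕ) (hl : ul ∈ M.Omegac) (hr : ur ∈ M.Omegaf) :
    M.IsFan ul (M.firstWave n ul M.Vc ++ (M.rhof (M.w2 ul), M.vf (M.rhof (M.w2 ul))) ::
      M.freeWave n (M.rhof (M.w2 ul), M.vf (M.rhof (M.w2 ul))) ur) ur := by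
  have hw := w2_mem_Icc_of_mem_Omegac hl
  have hf := mk_vf_rhof_mem_Omegaf₂ hw
  obtain ⟨hA, hneg⟩ := isFan_firstWave_append_singleton n hl hf (w2_mk_vf_rhof hw)
  rw [← List.singleton_append, ← List.append_assoc]
  exact hA.append (isFan_freeWave hf.1 hr) (Or.inr (iff_of_true hf.1 hr)) fun a ha b hb =>
    (hneg a ha).trans (speeds_freeWave_pos hf.1 hr b hb)

theorem isFan_riemann (n : ℕ) (hl : ul ∈ M.Omega) (hr : ur ∈ M.Omega) :
    M.IsFan ul (M.riemann n ul ur) ur := by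
  rw [riemann]
  split_ifs with h₁ h₂ h₂
  · exact isFan_freeWave h₁ h₂
  · exact isFan_freeToCongested h₁ ((mem_Omegac_iff_notMem_Omegaf hr).2 h₂)
  · exact isFan_congestedToFree n ((mem_Omegac_iff_notMem_Omegaf hl).2 h₁) h₂
  · exact isFan_congested n ((mem_Omegac_iff_notMem_Omegaf hl).2 h₁)
      ((mem_Omegac_iff_notMem_Omegaf hr).2 h₂)

/-! ### Fronts issuing from solved Riemann problems -/

theorem isPhaseTransition_profile {L : List (ℝ × State)} {x : ℝ} {up : State}
    (hΩ : ∀ u ∈ ul :: L.map Prod.snd, u ∈ M.Omega) :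
    M.IsPhaseTransition (profile ul L) x um up ↔ um = leftTrace ul L x ∧ up = rightTrace ul L x ∧
      ¬ (leftTrace ul L x ∈ M.Omegaf ↔ rightTrace ul L x ∈ M.Omegaf) := by
  have hl := mem_Omegac_iff_notMem_Omegaf (hΩ _ (leftTrace_mem ul L x))
  have hr := mem_Omegac_iff_notMem_Omegaf (hΩ _ (rightTrace_mem ul L x))
  constructor
  · rintro ⟨htl, htr, h⟩
    obtain rfl := tendsto_nhds_unique htl tendsto_profile_left
    obtain rfl := tendsto_nhds_unique htr tendsto_profile_right
    rw [hl, hr] at h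
    exact ⟨rfl, rfl, by tauto⟩
  · rintro ⟨rfl, rfl, h⟩
    refine ⟨tendsto_profile_left, tendsto_profile_right, ?_⟩
    rw [hl, hr]
    tauto

open Classical in
theorem phaseTransitions_profile {L : List (ℝ × State)}
    (hΩ : ∀ u ∈ ul :: L.map Prod.snd, u ∈ M.Omega) (hL : L.Pairwise fun a b => a.1 ≤ b.1) :
    M.phaseTransitions (profile ul L) = oddPoints (crossings M.Omegaf ul L) := by
  ext x
  rw [Finset.mem_coe, mem_oddPoints, odd_count_crossings hL]
  simp only [phaseTransitions, mem_ofPred_eq, isPhaseTransition_profile hΩ]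
  exact ⟨fun ⟨_, _, _, _, h⟩ => h, fun h => ⟨_, _, rfl, rfl, h⟩⟩

open Classical in
theorem numPT_profile_of_nodup {L : List (ℝ × State)}
    (hΩ : ∀ u ∈ ul :: L.map Prod.snd, u ∈ M.Omega) (hL : L.Pairwise fun a b => a.1 ≤ b.1)
    (hnodup : (crossings M.Omegaf ul L).Nodup) :
    M.numPT (profile ul L) = (crossings M.Omegaf ul L).length := by
  rw [numPT, phaseTransitions_profile hΩ hL, Set.ncard_coe_finset]
  exact (card_oddPoints_le _).antisymm (not_lt.1 fun h => card_oddPoints_lt_length_iff.1 h hnodup)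

/-- The rays of the fronts `L` across which the phase changes. -/
noncomputable def phaseRays (M : Model) (ul : State) (L : List (ℝ × State)) : List Ray :=
  crossings M.Omegaf ul (rays ul L)

/-- The properties of the fronts that issue from the jumps of a piecewise constant function. Of the
fronts that issue from the same point with the same speed at most one changes the phase. -/
structure IsResolved (M : Model) (ul : State) (L : List (ℝ × State)) : Prop where
  mem_Omega : ∀ u ∈ ul :: L.map Prod.snd, u ∈ M.Omega
  pairwise_le : (rays ul L).Pairwise fun a b => a.1 ≤ b.1
  admissible : JumpsSatisfy M.AdmissibleJump ul (rays ul L)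
  nodup : (M.phaseRays ul L).Nodup

namespace IsResolved

variable {L : List (ℝ × State)} {s x : ℝ}

theorem mem_Omega_evolve (h : M.IsResolved ul L) (s : ℝ) :
    ∀ u ∈ ul :: (evolve ul L s).map Prod.snd, u ∈ M.Omega := by
  rw [map_snd_evolve]
  exact h.mem_Omega

open Classical in
theorem phaseTransitions_evolve (h : M.IsResolved ul L) (hs₀ : 0 ≤ s)
    (hs : s ≤ (meetTimes ul L).minimum) :
    M.phaseTransitions (profile ul (evolve ul L s)) =
      oddPoints ((M.phaseRays ul L).map (position s)) := by
  rw [phaseTransitions_profile (h.mem_Omega_evolve s) (pairwise_evolve_le h.pairwise_le hs₀ hs),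
    evolve_eq_map_rays, crossings_map, phaseRays]

theorem nodup_map_position (h : M.IsResolved ul L) (hs₀ : 0 < s)
    (hs : s < (meetTimes ul L).minimum) : ((M.phaseRays ul L).map (position s)).Nodup := by
  refine List.Nodup.map_on (fun k hk k' hk' hkk' => ?_) h.nodup
  obtain ⟨a, ha, rfl⟩ := exists_mem_of_mem_crossings hk
  obtain ⟨b, hb, rfl⟩ := exists_mem_of_mem_crossings hk'
  rcases lt_trichotomy a.1 b.1 with hab | hab | hab
  · exact absurd hkk' (position_strictMono h.pairwise_le hs₀ hs ha hb hab).ne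
  · exact hab
  · exact absurd hkk' (position_strictMono h.pairwise_le hs₀ hs hb ha hab).ne'

theorem mem_phaseTransitions_evolve (h : M.IsResolved ul L) (hs₀ : 0 < s)
    (hs : s < (meetTimes ul L).minimum) :
    x ∈ M.phaseTransitions (profile ul (evolve ul L s)) ↔
      ∃ k ∈ M.phaseRays ul L, position s k = x := by
  classical
  rw [h.phaseTransitions_evolve hs₀.le hs.le, Finset.mem_coe,
    mem_oddPoints_of_nodup (h.nodup_map_position hs₀ hs), List.mem_map]

theorem finite_phaseTransitions (h : M.IsResolved ul L) (hs₀ : 0 ≤ s)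
    (hs : s ≤ (meetTimes ul L).minimum) :
    (M.phaseTransitions (profile ul (evolve ul L s))).Finite := by
  classical
  rw [h.phaseTransitions_evolve hs₀ hs]
  exact Finset.finite_toSet _

theorem numPT_le (h : M.IsResolved ul L) (hs₀ : 0 ≤ s) (hs : s ≤ (meetTimes ul L).minimum) :
    M.numPT (profile ul (evolve ul L s)) ≤ (M.phaseRays ul L).length := by
  classical
  rw [numPT, h.phaseTransitions_evolve hs₀ hs, Set.ncard_coe_finset]
  exact (card_oddPoints_le _).trans_eq (List.length_map _)

theorem even_length_sub_numPT (h : M.IsResolved ul L) (hs₀ : 0 ≤ s)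
    (hs : s ≤ (meetTimes ul L).minimum) :
    Even ((M.phaseRays ul L).length - M.numPT (profile ul (evolve ul L s))) := by
  classical
  rw [numPT, h.phaseTransitions_evolve hs₀ hs, Set.ncard_coe_finset,
    ← List.length_map (f := position s)]
  exact even_length_sub_card_oddPoints _

theorem numPT_lt_length_iff (h : M.IsResolved ul L) (hs₀ : 0 ≤ s)
    (hs : s ≤ (meetTimes ul L).minimum) :
    M.numPT (profile ul (evolve ul L s)) < (M.phaseRays ul L).length ↔
      ¬ ((M.phaseRays ul L).map (position s)).Nodup := by
  classical
  rw [← card_oddPoints_lt_length_iff, List.length_map, numPT, h.phaseTransitions_evolve hs₀ hs,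
    Set.ncard_coe_finset]

theorem numPT_eq_length (h : M.IsResolved ul L) (hs₀ : 0 < s)
    (hs : s < (meetTimes ul L).minimum) :
    M.numPT (profile ul (evolve ul L s)) = (M.phaseRays ul L).length :=
  (h.numPT_le hs₀.le hs.le).antisymm <| not_lt.1 fun hlt =>
    (h.numPT_lt_length_iff hs₀.le hs.le).1 hlt (h.nodup_map_position hs₀ hs)

theorem admissibleJump_evolve (h : M.IsResolved ul L) (hs₀ : 0 ≤ s)
    (hs : s ≤ (meetTimes ul L).minimum) {a : Ray × State} (ha : a ∈ rays ul L)
    (hinj : ∀ b ∈ rays ul L, position s b.1 = position s a.1 → b.1 = a.1) :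
    M.AdmissibleJump (leftTrace ul (evolve ul L s) (position s a.1))
      (rightTrace ul (evolve ul L s) (position s a.1)) := by
  have hmono : ∀ b ∈ rays ul L, ∀ c ∈ rays ul L, b.1 ≤ c.1 → position s b.1 ≤ position s c.1 :=
    fun b hb c hc => position_mono h.pairwise_le hs₀ hs hb hc
  rw [evolve_eq_map_rays, leftTrace_map (x := a.1), rightTrace_map (x := a.1)]
  · exact h.admissible a ha
  · exact fun b hb => ⟨fun hlt => lt_of_not_ge fun hle => (hmono b hb a ha hle).not_gt hlt,
      fun hlt => (hmono a ha b hb hlt.le).lt_of_ne' fun he => hlt.ne' (hinj b hb he)⟩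
  · exact fun b hb => ⟨fun hlt => lt_of_not_ge fun hle => (hmono a ha b hb hle).not_gt hlt,
      fun hlt => (hmono b hb a ha hlt.le).lt_of_ne fun he => hlt.ne (hinj b hb he)⟩

theorem not_continuousAt_evolve (h : M.IsResolved ul L) (hs₀ : 0 < s)
    (hs : s < (meetTimes ul L).minimum) {a : Ray × State} (ha : a ∈ rays ul L) :
    ¬ ContinuousAt (profile ul (evolve ul L s)) (position s a.1) := by
  refine not_continuousAt_profile (h.admissibleJump_evolve hs₀.le hs.le ha fun b hb he => ?_).1
  rcases lt_trichotomy a.1 b.1 with hab | hab | hab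
  · exact absurd he (position_strictMono h.pairwise_le hs₀ hs ha hb hab).ne'
  · exact hab.symm
  · exact absurd he (position_strictMono h.pairwise_le hs₀ hs hb ha hab).ne

theorem mem_Ge_or_exists_lt (h : M.IsResolved ul L) (hs₀ : 0 ≤ s)
    (hs : s ≤ (meetTimes ul L).minimum) {up : State}
    (hx : M.IsPhaseTransition (profile ul (evolve ul L s)) x um up) :
    (um, up) ∈ M.Ge ∨ ∃ a ∈ rays ul L, ∃ b ∈ rays ul L, a.1 < b.1 ∧
      position s a.1 = x ∧ position s b.1 = x := by
  classical
  have hmem : x ∈ M.phaseTransitions (profile ul (evolve ul L s)) := ⟨_, _, hx⟩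
  rw [h.phaseTransitions_evolve hs₀ hs, Finset.mem_coe, mem_oddPoints] at hmem
  obtain ⟨k, hk, rfl⟩ := List.mem_map.1 (List.count_pos_iff.1 hmem.pos)
  obtain ⟨a, ha, rfl⟩ := exists_mem_of_mem_crossings hk
  obtain ⟨rfl, rfl, hF⟩ := (isPhaseTransition_profile (h.mem_Omega_evolve s)).1 hx
  by_cases hinj : ∀ b ∈ rays ul L, position s b.1 = position s a.1 → b.1 = a.1
  · exact Or.inl ((h.admissibleJump_evolve hs₀ hs ha hinj).2 hF)
  · push Not at hinj
    obtain ⟨b, hb, he, hne⟩ := hinj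
    rcases hne.lt_or_gt with hlt | hlt
    · exact Or.inr ⟨b, hb, a, ha, hlt, he, rfl⟩
    · exact Or.inr ⟨a, ha, b, hb, hlt, rfl, he⟩

end IsResolved

theorem map_fst_rays (ul : State) (L : List (ℝ × State)) :
    (rays ul L).map (fun a => (ofLex a.1).1) = L.map Prod.fst := by
  induction L generalizing ul with
  | nil => rfl
  | cons a L ih => simp only [rays, List.map_cons, ih, ofLex_toLex]

theorem rays_map_mk (ul : State) (y : ℝ) (S : List State) :
    rays ul (S.map fun u => (y, u)) =
      (speeds ul S).map (Prod.map (fun c => toLex (y, c)) id) := by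
  induction S generalizing ul with
  | nil => rfl
  | cons u S ih => simp only [rays, speeds, List.map_cons, ih, Prod.map_apply, id_eq]

theorem strictMono_toLex_mk (y : ℝ) : StrictMono fun c : ℝ => toLex (y, c) := fun a b h => by
  simpa [Prod.Lex.lt_iff] using h

theorem IsFan.rays_append (hS : M.IsFan ul S um) (y : ℝ) (L : List (ℝ × State)) :
    rays ul (S.map (fun u => (y, u)) ++ L) =
      (speeds ul S).map (Prod.map (fun c => toLex (y, c)) id) ++ rays um L := by
  rw [TwoPhase.rays_append, rays_map_mk, List.map_map, Function.comp_def, List.map_id',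
    hS.getLastD_eq]

theorem IsFan.phaseRays_append (hS : M.IsFan ul S um) (y : ℝ) (L : List (ℝ × State)) :
    M.phaseRays ul (S.map (fun u => (y, u)) ++ L) =
      (crossings M.Omegaf ul (speeds ul S)).map (fun c => toLex (y, c)) ++ M.phaseRays um L := by
  rw [phaseRays, hS.rays_append, crossings_append, crossings_map, List.map_map]
  change _ ++ crossings _ (((speeds ul S).map Prod.snd).getLastD ul) _ = _
  rw [map_snd_speeds, hS.getLastD_eq, phaseRays]

theorem IsResolved.append {L : List (ℝ × State)} {y : ℝ} (hS : M.IsFan ul S um) (hul : ul ∈ M.Omega)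
    (hL : M.IsResolved um L) (hy : ∀ a ∈ L, y < a.1) :
    M.IsResolved ul (S.map (fun u => (y, u)) ++ L) := by
  have hlt : ∀ (c : ℝ), ∀ b ∈ rays um L, toLex (y, c) < b.1 := by
    intro c b hb
    have hb₁ := List.mem_map_of_mem (f := fun a : Ray × State => (ofLex a.1).1) hb
    rw [map_fst_rays] at hb₁
    obtain ⟨a, ha, he⟩ := List.mem_map.1 hb₁
    exact Prod.Lex.lt_iff.2 (Or.inl ((hy a ha).trans_eq he))
  have hlt' : ∀ a ∈ (speeds ul S).map (Prod.map (fun c => toLex (y, c)) id), ∀ b ∈ rays um L,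
      a.1 < b.1 := List.forall_mem_map.2 fun c _ => hlt c.1
  constructor
  · rw [List.map_append, List.map_map, Function.comp_def, List.map_id']
    exact List.forall_mem_cons.2 ⟨hul, List.forall_mem_append.2
      ⟨hS.mem_Omega, (List.forall_mem_cons.1 hL.mem_Omega).2⟩⟩
  · rw [hS.rays_append, List.pairwise_append, List.pairwise_map]
    exact ⟨hS.pairwise_le.imp fun h => (strictMono_toLex_mk y).monotone h, hL.pairwise_le,
      fun a ha b hb => (hlt' a ha b hb).le⟩
  · rw [hS.rays_append]
    refine (hS.admissible.map (strictMono_toLex_mk y)).append hlt' ?_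
    rw [List.map_map]
    change JumpsSatisfy _ (((speeds ul S).map Prod.snd).getLastD ul) _
    rw [map_snd_speeds, hS.getLastD_eq]
    exact hL.admissible
  · rw [hS.phaseRays_append, List.nodup_append]
    refine ⟨List.Nodup.map (strictMono_toLex_mk y).injective ?_, hL.nodup, ?_⟩
    · exact List.nodup_iff_count_le_one.2 fun c =>
        List.count_le_length.trans hS.length_crossings_le
    · refine List.forall_mem_map.2 fun c _ k hk => ?_
      obtain ⟨b, hb, rfl⟩ := exists_mem_of_mem_crossings hk
      exact (hlt c b hb).ne

theorem exists_of_mem_resolve {n : ℕ} {J : List (ℝ × State)} {a : ℝ × State}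
    (ha : a ∈ M.resolve n ul J) : ∃ b ∈ J, b.1 = a.1 := by
  induction J generalizing ul with
  | nil => simp [resolve] at ha
  | cons b J ih =>
    rcases List.mem_append.1 ha with ha | ha
    · obtain ⟨u, -, rfl⟩ := List.mem_map.1 ha
      exact ⟨b, List.mem_cons_self, rfl⟩
    · obtain ⟨c, hc, he⟩ := ih ha
      exact ⟨c, List.mem_cons_of_mem _ hc, he⟩

theorem isResolved_resolve (n : ℕ) {J : List (ℝ × State)} (hJ : J.Pairwise fun a b => a.1 < b.1)
    (hΩ : ∀ u ∈ ul :: J.map Prod.snd, u ∈ M.Omega) : M.IsResolved ul (M.resolve n ul J) := by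
  induction J generalizing ul with
  | nil =>
    exact ⟨hΩ, List.Pairwise.nil, fun _ h => absurd h List.not_mem_nil, List.nodup_nil⟩
  | cons b J ih =>
    obtain ⟨hb, hJ⟩ := List.pairwise_cons.1 hJ
    obtain ⟨hul, hΩ⟩ := List.forall_mem_cons.1 hΩ
    refine .append (isFan_riemann n hul (hΩ b.2 List.mem_cons_self)) hul (ih hJ hΩ) fun a ha => ?_
    obtain ⟨c, hc, he⟩ := exists_of_mem_resolve ha
    exact he ▸ hb c hc

theorem length_phaseRays_resolve (n : ℕ) {J : List (ℝ × State)}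
    (hΩ : ∀ u ∈ ul :: J.map Prod.snd, u ∈ M.Omega) :
    (M.phaseRays ul (M.resolve n ul J)).length = (crossings M.Omegaf ul J).length := by
  induction J generalizing ul with
  | nil => rfl
  | cons b J ih =>
    obtain ⟨hul, hΩ⟩ := List.forall_mem_cons.1 hΩ
    have hfan := isFan_riemann n hul (hΩ b.2 List.mem_cons_self)
    rw [resolve, hfan.phaseRays_append, List.length_append, List.length_map, ih hΩ,
      hfan.length_crossings, crossings]
    split_ifs
    · exact zero_add _
    · exact add_comm _ _

/-! ### The evolution of the number of phase transitions -/

section Tracking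

variable (M) (n : ℕ) (ul : State) (J : List (ℝ × State))

/-- The fronts issuing at the `k`-th interaction time. -/
noncomputable def frontsAt (k : ℕ) : List (ℝ × State) := (M.tracking n ul J k).2

/-- The `k`-th interaction time as a real number, with the junk value `0` if there are less than
`k` interaction times. -/
noncomputable def startTime (k : ℕ) : ℝ := (M.time n ul J k).untopD 0

/-- The times after the `k`-th interaction time, up to the next one. -/
def window (k : ℕ) : Set ℝ :=
  {t | M.time n ul J k < t ∧ (t : WithTop ℝ) ≤ M.time n ul J (k + 1)}

/-- The number of phase transitions right after the `k`-th interaction time. -/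
noncomputable def phaseChanges (k : ℕ) : ℕ := (M.phaseRays ul (M.frontsAt n ul J k)).length

variable {M n ul J} {k : ℕ} {s t x : ℝ}

theorem time_succ (k : ℕ) : M.time n ul J (k + 1) =
    M.time n ul J k + (meetTimes ul (M.frontsAt n ul J k)).minimum := rfl

theorem frontsAt_succ (k : ℕ) : M.frontsAt n ul J (k + 1) = M.resolve n ul (collapse
    (evolve ul (M.frontsAt n ul J k) ((meetTimes ul (M.frontsAt n ul J k)).minimum.untopD 0))) :=
  rfl

theorem startTime_lt (ht : t ∈ M.window n ul J k) : M.startTime n ul J k < t :=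
  WithTop.coe_lt_coe.1 ((WithTop.coe_untopD_le _ _).trans_lt ht.1)

theorem time_add_elapsed (ht : t ∈ M.window n ul J k) :
    M.time n ul J k + ((t - M.startTime n ul J k : ℝ) : WithTop ℝ) = t := by
  obtain ⟨a, ha⟩ := WithTop.ne_top_iff_exists.1 (ne_top_of_lt ht.1)
  rw [startTime, ← ha, WithTop.untopD_coe, ← WithTop.coe_add, add_sub_cancel]

theorem elapsed_le (ht : t ∈ M.window n ul J k) :
    ((t - M.startTime n ul J k : ℝ) : WithTop ℝ) ≤
      (meetTimes ul (M.frontsAt n ul J k)).minimum := by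
  rw [← WithTop.add_le_add_iff_left (ne_top_of_lt ht.1), time_add_elapsed ht]
  exact ht.2

theorem elapsed_lt (ht : t ∈ M.window n ul J k)
    (htk : (t : WithTop ℝ) < M.time n ul J (k + 1)) :
    ((t - M.startTime n ul J k : ℝ) : WithTop ℝ) <
      (meetTimes ul (M.frontsAt n ul J k)).minimum := by
  rw [← WithTop.add_lt_add_iff_left (ne_top_of_lt ht.1), time_add_elapsed ht]
  exact htk

theorem elapsed_eq (ht : t ∈ M.window n ul J k) (htk : t = M.time n ul J (k + 1)) :
    (meetTimes ul (M.frontsAt n ul J k)).minimum.untopD 0 = t - M.startTime n ul J k := by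
  have h : (meetTimes ul (M.frontsAt n ul J k)).minimum =
      ((t - M.startTime n ul J k : ℝ) : WithTop ℝ) := by
    rw [← WithTop.add_left_inj (ne_top_of_lt ht.1), time_add_elapsed ht, htk, time_succ]
  rw [h, WithTop.untopD_coe]

theorem mem_window_of_mem_Ioo (ht : t ∈ M.window n ul J k)
    (hs : s ∈ Ioo (M.startTime n ul J k) t) :
    s ∈ M.window n ul J k ∧ (s : WithTop ℝ) < M.time n ul J (k + 1) := by
  have hlt := (WithTop.coe_lt_coe.2 hs.2).trans_le ht.2
  exact ⟨⟨(WithTop.untopD_lt_iff (ne_top_of_lt ht.1)).1 hs.1, hlt.le⟩, hlt⟩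

theorem exists_mem_window (ht₀ : 0 < t) (ht : M.Reached n ul J t) :
    ∃ k, t ∈ M.window n ul J k := by
  obtain ⟨k, hk⟩ := ht
  induction k with
  | zero => exact absurd (WithTop.coe_le_coe.1 hk) ht₀.not_ge
  | succ k ih => exact (le_or_gt _ _).elim ih fun h => ⟨k, h, hk⟩

variable (hJ : J.Pairwise fun a b => a.1 < b.1) (hΩ : ∀ u ∈ ul :: J.map Prod.snd, u ∈ M.Omega)

theorem numPT_profile (hJ : J.Pairwise fun a b => a.1 < b.1)
    (hΩ : ∀ u ∈ ul :: J.map Prod.snd, u ∈ M.Omega) :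
    M.numPT (profile ul J) = (crossings M.Omegaf ul J).length :=
  numPT_profile_of_nodup hΩ (hJ.imp le_of_lt) <| (crossings_sublist _ _ _).nodup <|
    List.pairwise_map.2 (hJ.imp ne_of_lt)

theorem IsResolved.minimum_untopD {L : List (ℝ × State)} (h : M.IsResolved ul L) :
    0 ≤ (meetTimes ul L).minimum.untopD 0 ∧
      ((meetTimes ul L).minimum.untopD 0 : ℝ) ≤ (meetTimes ul L).minimum :=
  ⟨(WithTop.le_untopD_iff fun _ => le_rfl).2 (minimum_meetTimes_pos h.pairwise_le).le,
    WithTop.coe_untopD_le _ _⟩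

theorem IsResolved.pairwise_lt_collapse {L : List (ℝ × State)} (h : M.IsResolved ul L)
    (hs₀ : 0 ≤ s) (hs : s ≤ (meetTimes ul L).minimum) :
    (collapse (evolve ul L s)).Pairwise fun a b => a.1 < b.1 :=
  TwoPhase.pairwise_lt_collapse (pairwise_evolve_le h.pairwise_le hs₀ hs)

theorem IsResolved.mem_Omega_collapse {L : List (ℝ × State)} (h : M.IsResolved ul L) (s : ℝ) :
    ∀ u ∈ ul :: (collapse (evolve ul L s)).map Prod.snd, u ∈ M.Omega :=
  fun u hu => h.mem_Omega_evolve s u ((((collapse_sublist _).map Prod.snd).cons_cons ul).subset hu)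

include hJ hΩ

theorem isResolved_frontsAt (k : ℕ) : M.IsResolved ul (M.frontsAt n ul J k) := by
  induction k with
  | zero => exact isResolved_resolve n hJ hΩ
  | succ k ih =>
    rw [frontsAt_succ]
    exact isResolved_resolve n (ih.pairwise_lt_collapse ih.minimum_untopD.1 ih.minimum_untopD.2)
      (ih.mem_Omega_collapse _)

theorem phaseChanges_zero : M.phaseChanges n ul J 0 = M.numPT (profile ul J) :=
  (length_phaseRays_resolve n hΩ).trans (numPT_profile hJ hΩ).symm

theorem phaseChanges_succ (k : ℕ) : M.phaseChanges n ul J (k + 1) =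
    M.numPT (profile ul (evolve ul (M.frontsAt n ul J k)
      ((meetTimes ul (M.frontsAt n ul J k)).minimum.untopD 0))) := by
  have h := isResolved_frontsAt (n := n) hJ hΩ k
  rw [phaseChanges, frontsAt_succ, length_phaseRays_resolve n (h.mem_Omega_collapse _),
    ← numPT_profile (h.pairwise_lt_collapse h.minimum_untopD.1 h.minimum_untopD.2)
      (h.mem_Omega_collapse _), profile_collapse]

theorem antitone_phaseChanges : Antitone (M.phaseChanges n ul J) :=
  antitone_nat_of_succ_le fun k => by
    have h := isResolved_frontsAt (n := n) hJ hΩ k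
    exact (phaseChanges_succ hJ hΩ k).trans_le
      (h.numPT_le h.minimum_untopD.1 h.minimum_untopD.2)

theorem even_phaseChanges_sub {i j : ℕ} (hij : i ≤ j) :
    Even (M.phaseChanges n ul J i - M.phaseChanges n ul J j) := by
  have hanti := antitone_phaseChanges (n := n) hJ hΩ
  induction j, hij using Nat.le_induction with
  | base => simp
  | succ j hij ih =>
    have h := isResolved_frontsAt (n := n) hJ hΩ j
    have hstep : Even (M.phaseChanges n ul J j - M.phaseChanges n ul J (j + 1)) := by
      rw [phaseChanges_succ hJ hΩ]
      exact h.even_length_sub_numPT h.minimum_untopD.1 h.minimum_untopD.2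
    rw [← Nat.sub_add_sub_cancel (hanti hij) (hanti j.le_succ)]
    exact ih.add hstep

theorem time_lt_time_succ (hk : M.time n ul J k ≠ ⊤) :
    M.time n ul J k < M.time n ul J (k + 1) := by
  have hpos := minimum_meetTimes_pos (isResolved_frontsAt (n := n) hJ hΩ k).pairwise_le
  simpa only [add_zero, time_succ] using WithTop.add_lt_add_left hk hpos

theorem monotone_time : Monotone (M.time n ul J) := by
  refine monotone_nat_of_le_succ fun k => ?_
  by_cases hk : M.time n ul J k = ⊤
  · rw [time_succ, hk, top_add]
  · exact (time_lt_time_succ hJ hΩ hk).le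

theorem approx_zero : M.approx n ul J 0 = profile ul J := by
  funext x
  refine dif_neg fun ⟨k, hk, _⟩ => ?_
  exact hk.not_ge (monotone_time hJ hΩ k.zero_le)

theorem approx_eq_of_mem_window (ht : t ∈ M.window n ul J k) :
    M.approx n ul J t =
      profile ul (evolve ul (M.frontsAt n ul J k) (t - M.startTime n ul J k)) := by
  have h : ∃ k, M.time n ul J k < t ∧ (t : WithTop ℝ) ≤ M.time n ul J (k + 1) := ⟨k, ht⟩
  have hk : h.choose = k :=
    (monotone_time hJ hΩ).pairwise_disjoint_on_Ioc_succ.eq <|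
      not_disjoint_iff.2 ⟨t, h.choose_spec, ht⟩
  funext x
  rw [approx, dif_pos h, hk]
  rfl

theorem finite_phaseTransitions_approx (ht₀ : 0 ≤ t) (ht : M.Reached n ul J t) :
    (M.phaseTransitions (M.approx n ul J t)).Finite := by
  classical
  rcases ht₀.eq_or_lt with rfl | ht₀
  · rw [approx_zero hJ hΩ, phaseTransitions_profile hΩ (hJ.imp le_of_lt)]
    exact Finset.finite_toSet _
  · obtain ⟨k, hk⟩ := exists_mem_window ht₀ ht
    rw [approx_eq_of_mem_window hJ hΩ hk]
    exact (isResolved_frontsAt hJ hΩ k).finite_phaseTransitions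
      (sub_pos.2 (startTime_lt hk)).le (elapsed_le hk)

theorem numPT_approx_of_mem_window (ht : t ∈ M.window n ul J k) :
    M.numPT (M.approx n ul J t) =
      M.phaseChanges n ul J (if t = M.time n ul J (k + 1) then k + 1 else k) := by
  rw [approx_eq_of_mem_window hJ hΩ ht]
  split_ifs with htk
  · rw [phaseChanges_succ hJ hΩ, elapsed_eq ht htk]
  · exact (isResolved_frontsAt hJ hΩ k).numPT_eq_length (sub_pos.2 (startTime_lt ht))
      (elapsed_lt ht (ht.2.lt_of_ne htk))

theorem numPT_approx (hk : M.time n ul J k ≤ t) (hk' : (t : WithTop ℝ) < M.time n ul J (k + 1)) :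
    M.numPT (M.approx n ul J t) = M.phaseChanges n ul J k := by
  rcases hk.lt_or_eq with hlt | heq
  · rw [numPT_approx_of_mem_window hJ hΩ ⟨hlt, hk'.le⟩, if_neg hk'.ne]
  cases k with
  | zero =>
    obtain rfl : (0 : ℝ) = t := WithTop.coe_eq_coe.1 heq
    rw [approx_zero hJ hΩ, phaseChanges_zero hJ hΩ]
  | succ k =>
    have hne : M.time n ul J k ≠ ⊤ := fun h =>
      WithTop.coe_ne_top <| heq.symm.trans <| by rw [time_succ, h, top_add]
    have ht : t ∈ M.window n ul J k := ⟨heq ▸ time_lt_time_succ hJ hΩ hne, heq.ge⟩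
    rw [numPT_approx_of_mem_window hJ hΩ ht, if_pos heq.symm]

theorem exists_time_le_lt (ht₀ : 0 ≤ t) (ht : M.Reached n ul J t) :
    ∃ k, M.time n ul J k ≤ t ∧ (t : WithTop ℝ) < M.time n ul J (k + 1) := by
  rcases ht₀.eq_or_lt with rfl | ht₀
  · exact ⟨0, le_rfl, time_lt_time_succ hJ hΩ WithTop.zero_ne_top⟩
  · obtain ⟨k, hk⟩ := exists_mem_window ht₀ ht
    rcases hk.2.lt_or_eq with hlt | heq
    · exact ⟨k, hk.1.le, hlt⟩
    · exact ⟨k + 1, heq.ge, heq ▸ time_lt_time_succ hJ hΩ (heq ▸ WithTop.coe_ne_top)⟩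

theorem meetAt_of_position_eq {P : ℝ → ℝ → Prop} (ht : t ∈ M.window n ul J k)
    {a b : Ray × State} (ha : a ∈ rays ul (M.frontsAt n ul J k))
    (hb : b ∈ rays ul (M.frontsAt n ul J k)) (hab : a.1 < b.1)
    (hax : position (t - M.startTime n ul J k) a.1 = x)
    (hbx : position (t - M.startTime n ul J k) b.1 = x)
    (hP : ∀ s ∈ M.window n ul J k, (s : WithTop ℝ) < M.time n ul J (k + 1) →
      P s (position (s - M.startTime n ul J k) a.1) ∧
        P s (position (s - M.startTime n ul J k) b.1)) : MeetAt P t x := by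
  have hcont (κ : Ray) : Continuous fun s => position (s - M.startTime n ul J k) κ :=
    (continuous_position κ).comp (continuous_id.sub continuous_const)
  refine meetAt_of_continuous (startTime_lt ht) (hcont a.1) (hcont b.1) hax hbx fun s hs => ?_
  obtain ⟨hsk, hlt⟩ := mem_window_of_mem_Ioo ht hs
  exact ⟨position_strictMono (isResolved_frontsAt hJ hΩ k).pairwise_le (sub_pos.2 hs.1)
    (elapsed_lt hsk hlt) ha hb hab, hP s hsk hlt⟩

theorem mem_Ge_of_isPhaseTransition (ht₀ : 0 < t) (ht : M.Reached n ul J t)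
    (hx : ¬ FrontsInteract (M.approx n ul J) t x)
    (h : M.IsPhaseTransition (M.approx n ul J t) x um ur) : (um, ur) ∈ M.Ge := by
  obtain ⟨k, hk⟩ := exists_mem_window ht₀ ht
  have hres := isResolved_frontsAt (n := n) hJ hΩ k
  rw [approx_eq_of_mem_window hJ hΩ hk] at h
  refine (hres.mem_Ge_or_exists_lt (sub_pos.2 (startTime_lt hk)).le (elapsed_le hk) h).resolve_right
    fun ⟨a, ha, b, hb, hab, hax, hbx⟩ => hx ?_
  refine meetAt_of_position_eq hJ hΩ hk ha hb hab hax hbx fun s hs hsk => ?_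
  rw [approx_eq_of_mem_window hJ hΩ hs]
  have hs₀ := sub_pos.2 (startTime_lt hs)
  exact ⟨hres.not_continuousAt_evolve hs₀ (elapsed_lt hs hsk) ha,
    hres.not_continuousAt_evolve hs₀ (elapsed_lt hs hsk) hb⟩

theorem mem_phaseTransitions_approx (hs : s ∈ M.window n ul J k)
    (hsk : (s : WithTop ℝ) < M.time n ul J (k + 1)) :
    x ∈ M.phaseTransitions (M.approx n ul J s) ↔
      ∃ κ ∈ M.phaseRays ul (M.frontsAt n ul J k), position (s - M.startTime n ul J k) κ = x := by
  rw [approx_eq_of_mem_window hJ hΩ hs]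
  exact (isResolved_frontsAt hJ hΩ k).mem_phaseTransitions_evolve
    (sub_pos.2 (startTime_lt hs)) (elapsed_lt hs hsk)

theorem exists_phaseTransitionsInteract_iff (ht : t ∈ M.window n ul J k) :
    (∃ x, M.PhaseTransitionsInteract (M.approx n ul J) t x) ↔
      ¬ ((M.phaseRays ul (M.frontsAt n ul J k)).map
        (position (t - M.startTime n ul J k))).Nodup := by
  rw [List.nodup_map_iff_inj_on (isResolved_frontsAt hJ hΩ k).nodup]
  constructor
  · rintro ⟨x, hx⟩ hinj
    have hP : ∀ᶠ s in 𝓝[<] t, ∀ y, y ∈ M.phaseTransitions (M.approx n ul J s) →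
        ∃ κ ∈ {κ | κ ∈ M.phaseRays ul (M.frontsAt n ul J k)},
          position (s - M.startTime n ul J k) κ = y := by
      filter_upwards [Ioo_mem_nhdsLT (startTime_lt ht)] with s hs y
      obtain ⟨hsk, hlt⟩ := mem_window_of_mem_Ioo ht hs
      exact (mem_phaseTransitions_approx hJ hΩ hsk hlt).1
    obtain ⟨κ, hκ, κ', hκ', hne, hx, hx'⟩ := MeetAt.exists_ne_apply_eq (List.finite_toSet _)
      (fun κ _ => (continuous_position κ).comp (continuous_id.sub continuous_const)) hP hx
    exact hne (hinj κ hκ κ' hκ' (hx.trans hx'.symm))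
  · intro hinj
    push Not at hinj
    obtain ⟨κ, hκ, κ', hκ', he, hne⟩ := hinj
    wlog hlt : κ < κ' generalizing κ κ'
    · exact this κ' hκ' κ hκ he.symm hne.symm ((not_lt.1 hlt).lt_of_ne hne.symm)
    obtain ⟨a, ha, rfl⟩ := exists_mem_of_mem_crossings hκ
    obtain ⟨b, hb, rfl⟩ := exists_mem_of_mem_crossings hκ'
    exact ⟨_, meetAt_of_position_eq hJ hΩ ht ha hb hlt he rfl fun s hs hsk =>
      ⟨(mem_phaseTransitions_approx hJ hΩ hs hsk).2 ⟨a.1, hκ, rfl⟩,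
        (mem_phaseTransitions_approx hJ hΩ hs hsk).2 ⟨b.1, hκ', rfl⟩⟩⟩

theorem exists_interact_iff_lt (ht : t ∈ M.window n ul J k) :
    (∃ x, M.PhaseTransitionsInteract (M.approx n ul J) t x) ↔
      t = M.time n ul J (k + 1) ∧ M.phaseChanges n ul J (k + 1) < M.phaseChanges n ul J k := by
  have hlt := (isResolved_frontsAt (n := n) hJ hΩ k).numPT_lt_length_iff
    (sub_pos.2 (startTime_lt ht)).le (elapsed_le ht)
  rw [← approx_eq_of_mem_window hJ hΩ ht, numPT_approx_of_mem_window hJ hΩ ht] at hlt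
  rw [exists_phaseTransitionsInteract_iff hJ hΩ ht, ← hlt, phaseChanges]
  split_ifs with htk <;> simp [htk, phaseChanges]

theorem phaseChanges_lt_iff {i j : ℕ} (hij : i ≤ j)
    (hi : M.time n ul J i ≤ s) (hi' : (s : WithTop ℝ) < M.time n ul J (i + 1))
    (hj : M.time n ul J j ≤ t) (hj' : (t : WithTop ℝ) < M.time n ul J (j + 1)) :
    M.phaseChanges n ul J j < M.phaseChanges n ul J i ↔
      ∃ τ ∈ Ioc s t, ∃ x, M.PhaseTransitionsInteract (M.approx n ul J) τ x := by
  have hmono := monotone_time (n := n) hJ hΩ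
  rw [lt_iff_exists_succ_lt (antitone_phaseChanges hJ hΩ) hij]
  constructor
  · rintro ⟨k, hik, hkj, hlt⟩
    obtain ⟨τ, hτ⟩ := WithTop.ne_top_iff_exists.1
      (ne_top_of_le_ne_top WithTop.coe_ne_top ((hmono hkj).trans hj))
    have hsτ : s < τ :=
      WithTop.coe_lt_coe.1 (hi'.trans_le ((hmono (Nat.succ_le_succ hik)).trans hτ.ge))
    have hτk : τ ∈ M.window n ul J k :=
      ⟨hτ ▸ time_lt_time_succ hJ hΩ (ne_top_of_le_ne_top WithTop.coe_ne_top
        ((hmono k.le_succ).trans hτ.ge)), hτ.le⟩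
    exact ⟨τ, ⟨hsτ, WithTop.coe_le_coe.1 (hτ.trans_le ((hmono hkj).trans hj))⟩,
      (exists_interact_iff_lt hJ hΩ hτk).2 ⟨hτ, hlt⟩⟩
  · rintro ⟨τ, ⟨hsτ, hτt⟩, hx⟩
    have hτ₀ : 0 < τ :=
      (WithTop.coe_le_coe.1 ((hmono i.zero_le).trans hi)).trans_lt hsτ
    have hτj := (WithTop.coe_le_coe.2 hτt).trans_lt hj'
    obtain ⟨k, hk⟩ := exists_mem_window hτ₀ ⟨j + 1, hτj.le⟩
    obtain ⟨hτk, hlt⟩ := (exists_interact_iff_lt hJ hΩ hk).1 hx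
    have hik := hi.trans_lt ((WithTop.coe_lt_coe.2 hsτ).trans_le hτk.le)
    exact ⟨k, Nat.lt_succ_iff.1 (hmono.reflect_lt hik),
      Nat.lt_of_succ_lt_succ (hmono.reflect_lt (hτk.symm.trans_lt hτj)), hlt⟩

theorem numPT_evolution (hs₀ : 0 ≤ s) (hst : s ≤ t) (ht : M.Reached n ul J t) :
    M.numPT (M.approx n ul J t) ≤ M.numPT (M.approx n ul J s) ∧
      (M.numPT (M.approx n ul J t) < M.numPT (M.approx n ul J s) ↔
        ∃ τ ∈ Ioc s t, ∃ x, M.PhaseTransitionsInteract (M.approx n ul J) τ x) ∧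
      Even (M.numPT (M.approx n ul J s) - M.numPT (M.approx n ul J t)) := by
  have hs : M.Reached n ul J s := ht.imp fun _ => (WithTop.coe_le_coe.2 hst).trans
  obtain ⟨i, hi, hi'⟩ := exists_time_le_lt hJ hΩ hs₀ hs
  obtain ⟨j, hj, hj'⟩ := exists_time_le_lt hJ hΩ (hs₀.trans hst) ht
  have hij : i ≤ j := Nat.lt_succ_iff.1 <| (monotone_time hJ hΩ).reflect_lt <|
    hi.trans_lt ((WithTop.coe_le_coe.2 hst).trans_lt hj')
  rw [numPT_approx hJ hΩ hi hi', numPT_approx hJ hΩ hj hj']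
  exact ⟨antitone_phaseChanges hJ hΩ hij, phaseChanges_lt_iff hJ hΩ hij hi hi' hj hj',
    even_phaseChanges_sub hJ hΩ hij⟩

end Tracking

end Model

end TwoPhase

theorem lemma2p5_general (M : TwoPhase.Model) (n : ℕ) (ul : TwoPhase.State)
    (J : List (ℝ × TwoPhase.State)) (hJ : (J.map Prod.fst).Pairwise (· < ·))
    (hul : ul ∈ M.Omega) (hJΩ : ∀ a ∈ J, a.2 ∈ M.Omega) :
    (∀ t, 0 < t → M.Reached n ul J t → ∀ x um up,
      ¬ TwoPhase.FrontsInteract (M.approx n ul J) t x →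
      M.IsPhaseTransition (M.approx n ul J t) x um up → (um, up) ∈ M.Ge) ∧
    (∀ t, 0 ≤ t → M.Reached n ul J t → (M.phaseTransitions (M.approx n ul J t)).Finite) ∧
    ∀ s t, 0 ≤ s → s ≤ t → M.Reached n ul J t →
      M.numPT (M.approx n ul J t) ≤ M.numPT (M.approx n ul J s) ∧
      (M.numPT (M.approx n ul J t) < M.numPT (M.approx n ul J s) ↔
        ∃ τ ∈ Set.Ioc s t, ∃ x, M.PhaseTransitionsInteract (M.approx n ul J) τ x) ∧
      Even (M.numPT (M.approx n ul J s) - M.numPT (M.approx n ul J t)) := by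
  have hJ : J.Pairwise fun a b => a.1 < b.1 := List.pairwise_map.1 hJ
  have hΩ : ∀ u ∈ ul :: J.map Prod.snd, u ∈ M.Omega :=
    List.forall_mem_cons.2 ⟨hul, List.forall_mem_map.2 hJΩ⟩
  exact ⟨fun _ ht₀ ht _ _ _ hx h =>
      TwoPhase.Model.mem_Ge_of_isPhaseTransition hJ hΩ ht₀ ht hx h,
    fun _ ht₀ ht => TwoPhase.Model.finite_phaseTransitions_approx hJ hΩ ht₀ ht,
    fun _ _ hs₀ hst ht => TwoPhase.Model.numPT_evolution hJ hΩ hs₀ hst ht⟩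

theorem lemma2p5 (M : TwoPhase.Model) (n : ℕ)
    -- the initial datum: leftmost state and jumps, with values in the grid
    (ul : TwoPhase.State) (J : List (ℝ × TwoPhase.State))
    (hJ : (J.map Prod.fst).Pairwise (· < ·))
    (hul : ul ∈ M.grid n) (hJn : ∀ a ∈ J, a.2 ∈ M.grid n) :
    -- condition (E.3), away from the interaction points
    (∀ t, 0 < t → M.Reached n ul J t → ∀ x um up,
      ¬ TwoPhase.FrontsInteract (M.approx n ul J) t x →
      M.IsPhaseTransition (M.approx n ul J t) x um up → (um, up) ∈ M.Ge) ∧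
    -- the number of phase transitions is finite
    (∀ t, 0 ≤ t → M.Reached n ul J t → (M.phaseTransitions (M.approx n ul J t)).Finite) ∧
    -- its evolution between two times
    ∀ s t, 0 ≤ s → s ≤ t → M.Reached n ul J t →
      M.numPT (M.approx n ul J t) ≤ M.numPT (M.approx n ul J s) ∧
      (M.numPT (M.approx n ul J t) < M.numPT (M.approx n ul J s) ↔
        ∃ τ ∈ Set.Ioc s t, ∃ x, M.PhaseTransitionsInteract (M.approx n ul J) τ x) ∧
      Even (M.numPT (M.approx n ul J s) - M.numPT (M.approx n ul J t)) :=
  lemma2p5_general M n ul J hJ hul.1 fun a ha => (hJn a ha).1
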